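/- Let $\mathbb{T}=\mathbb{R}/\mathbb{Z}$. For a finite non-negative Borel measure $\mu$ on $\mathbb{T}$, let $$\dim_{\mathrm H}(\mu)=\inf\{\alpha:\ \text{there exists a Borel set } F\subset\mathbb{T}\text{ with }\mu(F)\neq 0\text{ and }\dim_{\mathrm H}F\le\alpha\}$$ be its lower Hausdorff dimension. For an integer $q\ge 4$ and $a\in[-1,1]$ let $$\mu_{a,q}=\prod_{k=0}^{\infty}\bigl(1+a\cos(2\pi q^k x)\bigr)$$ be the Riesz product, i.e. the weak limit, as $N\to\infty$, of the measures $\prod_{k=0}^{N-1}\bigl(1+a\cos(2\pi q^kx)\bigr)\,dx$ on $\mathbb{T}$. For every even integer $q\ge 4$ and every $a\in[-1,1]$, this weak limit exists, the integral $$I_q=\int_{\pi/2}^{q\pi/4}\log(\cos^2 z)\,\sin\frac{2z}{q}\,dz$$ converges absolutely, and both of the following inequalities hold: $$\dim_{\mathrm H}(\mu_{a,q})\ \ge\ 1-\frac{1-\log 2}{\log q}-\frac{1}{q\log q}\Bigl(2\log 2-\frac{2}{q\cos\frac{\pi}{q}}\,I_q\Bigr)-\frac{\log\cos\frac{\pi}{q}}{\log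 q},$$ $$\dim_{\mathrm H}(\mu_{a,q})\ \ge\ 1-\frac{1-\log 2}{\log q}-\frac{1}{q\log q}\Bigl(2\log 2+\frac{2}{q\cos\frac{\pi}{q}}\,I_q\Bigr)+\frac{\log\cos\frac{\pi}{q}}{\log q}.$$ -/

import Mathlib

open MeasureTheory Filter Topology
open scoped ENNReal

/-- The lower Hausdorff dimension of a measure `μ`: the infimum of those `α` for which some Borel
set `F` of Hausdorff dimension at most `α` has `μ F ≠ 0`. -/
noncomputable def lowerHausdorffDim {X : Type*} [EMetricSpace X] [MeasurableSpace X]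
    (μ : Measure X) : ℝ≥0∞ :=
  sInf {α : ℝ≥0∞ | ∃ F : Set X, MeasurableSet F ∧ μ F ≠ 0 ∧ dimH F ≤ α}

/-- The partial product `∏_{k < N} (1 + a cos (2π q ^ k x))` on the circle `ℝ / ℤ`; the real part
of the character `fourier n` at `x` is `cos (2π n x)`, see `rieszPartial_coe`. -/
noncomputable def rieszPartial (a : ℝ) (q N : ℕ) (x : UnitAddCircle) : ℝ :=
  ∏ k ∈ Finset.range N, (1 + a * (fourier ((q : ℤ) ^ k) x).re)

theorem rieszPartial_coe (a : ℝ) (q N : ℕ) (t : ℝ) :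
    rieszPartial a q N (t : UnitAddCircle) =
      ∏ k ∈ Finset.range N, (1 + a * Real.cos (2 * Real.pi * (q : ℝ) ^ k * t)) := by
  unfold rieszPartial
  refine Finset.prod_congr rfl fun k _ => ?_
  rw [fourier_coe_apply]
  have h : (2 * (Real.pi : ℂ) * Complex.I * (((q : ℤ) ^ k : ℤ) : ℂ) * (t : ℂ) / ((1 : ℝ) : ℂ))
      = ((2 * Real.pi * (q : ℝ) ^ k * t : ℝ) : ℂ) * Complex.I := by
    push_cast
    ring
  rw [h, Complex.exp_ofReal_mul_I_re]

theorem continuous_rieszPartial (a : ℝ) (q N : ℕ) : Continuous (rieszPartial a q N) := by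
  unfold rieszPartial
  fun_prop

/-- The measure with density `rieszPartial a q N` with respect to Lebesgue measure on the circle
(the density is nonnegative when `|a| ≤ 1`). -/
noncomputable def rieszPartialMeasure (a : ℝ) (q N : ℕ) : FiniteMeasure UnitAddCircle :=
  ⟨(volume : Measure UnitAddCircle).withDensity fun x => ENNReal.ofReal (rieszPartial a q N x),
    isFiniteMeasure_withDensity_ofReal
      ((continuous_rieszPartial a q N).integrable_of_hasCompactSupport
        (HasCompactSupport.of_compactSpace _)).2⟩

/-- The Riesz product `∏_{k ≥ 0} (1 + a cos (2π q ^ k x))`: the weak limit of the measures whose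
densities are the partial products. -/
noncomputable def rieszProduct (a : ℝ) (q : ℕ) : FiniteMeasure UnitAddCircle :=
  limUnder atTop (rieszPartialMeasure a q)

/-- The integral `∫_{π/2}^{qπ/4} log (cos² z) sin (2z/q) dz`. -/
noncomputable def rieszIntegral (q : ℕ) : ℝ :=
  ∫ z in (Real.pi / 2)..(q * Real.pi / 4),
    Real.log (Real.cos z ^ 2) * Real.sin (2 * z / q)

/-!
The partial products satisfy `P (n + m) x = P n x * P m (q ^ n • x)`, and the second factor is
invariant under translation by `q ^ (-n)`. Integrals against the Riesz product `μ` can therefore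
be estimated by averaging over cosets of the `q ^ n`-torsion (`integral_mul_comp_nsmul_le`). No
ergodic theorem is needed, only one-step averages of `w = 1 + a cos (2π x)` over the translates
of the `q`-torsion.

*Weak limit.* Every Fourier coefficient of the partial products is eventually constant, so in the
compact space of probability measures they have exactly one cluster point.

*Dimension.* If `c` exceeds every such average of `w log w`, a second order expansion shows that
the averages of `w ^ (1 + δ)` are at most `exp (δ c)` for small `δ > 0`, hence
`∫ (P n) ^ δ dμ ≤ exp (n δ c)`. By Markov and Borel–Cantelli, `P n ≤ exp (n c')` eventually,
`μ`-almost everywhere, for every `c' > c`. Where `P n ≤ exp (n c')`, balls of radius `q ^ (-n)` have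
mass at most `5 exp (n c') q ^ (-n)`, because the remaining factor has mean one and is
`q ^ (-n)`-periodic. The mass distribution principle gives dimension at least `1 - c' / log q`
(`le_lowerHausdorffDim_rieszProduct`).

*Entropy average.* By convexity and evenness the worst case is `a = 1`. The cosine coefficients of
`(1 + cos θ) log (1 + cos θ)` are `2 (-1) ^ n / (n (n ^ 2 - 1))` for `n ≥ 2`, and averaging keeps
only the multiples of the even number `q`, so the average is at most
`1 - log 2 + ∑ 2 / (q k ((q k) ^ 2 - 1))`. The estimate is made for `log (1 + 2 r cos θ + r ^ 2)` with
`r < 1`, where the series converges absolutely, before letting `r` tend to `1`.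

*Comparison.* The same series, integrated term by term against `sin (2 z / q)`, evaluates the
integral in the statement: with `J = 2 log 2 / q + 2 I / (q ^ 2 cos (π / q))` one finds that `J` is
this very sum. The bounds `0 ≤ J ≤ π ^ 2 / (3 q (q ^ 2 - 1))` then suffice, because
`-log (cos (π / q))` lies between `2 / q ^ 2` and `2 / q`.
-/

/-! ### Partial products and integration along `x ↦ Q • x` -/

theorem fourier_nsmul (n : ℤ) (k : ℕ) (x : UnitAddCircle) :
    fourier n (k • x) = fourier (n * k) x := by
  rw [fourier_apply, fourier_apply, ← natCast_zsmul x k, smul_smul]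

theorem rieszPartial_nonneg {a : ℝ} (ha : a ∈ Set.Icc (-1 : ℝ) 1) (q N : ℕ) (x : UnitAddCircle) :
    0 ≤ rieszPartial a q N x := by
  induction x using QuotientAddGroup.induction_on with
  | H t =>
    refine (rieszPartial_coe a q N t).symm ▸ Finset.prod_nonneg fun k _ => ?_
    have hc := Real.abs_cos_le_one (2 * Real.pi * (q : ℝ) ^ k * t)
    have : |a * Real.cos (2 * Real.pi * (q : ℝ) ^ k * t)| ≤ 1 := by
      rw [abs_mul]
      exact mul_le_one₀ (abs_le.2 ha) (abs_nonneg _) hc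
    linarith [(abs_le.1 this).1]

theorem rieszPartial_zero (a : ℝ) (q : ℕ) (x : UnitAddCircle) : rieszPartial a q 0 x = 1 := by
  simp [rieszPartial]

theorem rieszPartial_succ (a : ℝ) (q N : ℕ) (x : UnitAddCircle) :
    rieszPartial a q (N + 1) x = rieszPartial a q N x * (1 + a * (fourier ((q : ℤ) ^ N) x).re) :=
  Finset.prod_range_succ _ _

theorem rieszPartial_add (a : ℝ) (q n m : ℕ) (x : UnitAddCircle) :
    rieszPartial a q (n + m) x = rieszPartial a q n x * rieszPartial a q m (q ^ n • x) := by
  unfold rieszPartial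
  rw [Finset.prod_range_add]
  congr 1
  refine Finset.prod_congr rfl fun k _ => ?_
  rw [fourier_nsmul, pow_add, mul_comm ((q : ℤ) ^ n), Nat.cast_pow]

theorem rieszPartial_one_coe (a : ℝ) (q : ℕ) (t : ℝ) :
    rieszPartial a q 1 (t : UnitAddCircle) = 1 + a * Real.cos (2 * Real.pi * t) := by
  simp [rieszPartial_coe]

theorem integrable_of_continuous {E : Type*} [NormedAddCommGroup E] {μ : Measure UnitAddCircle}
    [IsFiniteMeasure μ] {f : UnitAddCircle → E} (hf : Continuous f) : Integrable f μ :=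
  hf.integrable_of_hasCompactSupport (HasCompactSupport.of_compactSpace _)

theorem nsmul_coe_div {Q : ℕ} (hQ : Q ≠ 0) (i : ℕ) :
    Q • (((i : ℝ) / Q : ℝ) : UnitAddCircle) = 0 := by
  rw [← AddCircle.coe_nsmul, nsmul_eq_mul, mul_div_cancel₀ _ (Nat.cast_ne_zero.2 hQ),
    AddCircle.coe_eq_zero_iff]
  exact ⟨i, by simp⟩

theorem integral_comp_nsmul {Q : ℕ} (hQ : Q ≠ 0) {h : UnitAddCircle → ℝ} (hh : Continuous h) :
    ∫ x, h (Q • x) = ∫ x, h x := by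
  rcases Nat.lt_or_ge 1 Q with h1 | h1
  · have hm := (AddCircle.ergodic_nsmul (T := 1) h1).toMeasurePreserving
    rw [← integral_map (φ := fun y : UnitAddCircle => Q • y) hm.measurable.aemeasurable
      hh.aestronglyMeasurable, hm.map_eq]
  · obtain rfl : Q = 1 := by omega
    simp

/-- Since `h (Q • x)` is invariant under the translations by `i / Q`, the factor `g` may be
replaced by its average over the coset of `ℤ / Q`. -/
theorem integral_mul_comp_nsmul {Q : ℕ} (hQ : Q ≠ 0) {g h : UnitAddCircle → ℝ}
    (hg : Continuous g) (hh : Continuous h) :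
    ∫ x, g x * h (Q • x) =
      ∫ x, ((∑ i ∈ Finset.range Q, g (x + ((i : ℝ) / Q : ℝ))) / Q) * h (Q • x) := by
  have key : ∀ i : ℕ, ∫ x, g (x + ((i : ℝ) / Q : ℝ)) * h (Q • x) = ∫ x, g x * h (Q • x) := by
    intro i
    rw [← integral_add_right_eq_self (fun x => g x * h (Q • x)) (((i : ℝ) / Q : ℝ) : UnitAddCircle)]
    simp only [smul_add, nsmul_coe_div hQ, add_zero]
  have hQ' : (Q : ℝ) ≠ 0 := Nat.cast_ne_zero.2 hQ
  have h2 : ∀ x, ((∑ i ∈ Finset.range Q, g (x + ((i : ℝ) / Q : ℝ))) / Q) * h (Q • x) =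
      (Q : ℝ)⁻¹ * ∑ i ∈ Finset.range Q, g (x + ((i : ℝ) / Q : ℝ)) * h (Q • x) := by
    intro x
    rw [← Finset.sum_mul]
    ring
  simp_rw [h2]
  rw [integral_const_mul, integral_finsetSum]
  · simp only [key, Finset.sum_const, Finset.card_range, nsmul_eq_mul]
    field_simp
  · intro i _
    exact integrable_of_continuous (by fun_prop)

theorem integral_mul_comp_nsmul_le {Q : ℕ} (hQ : Q ≠ 0) {g h : UnitAddCircle → ℝ}
    (hg : Continuous g) (hh : Continuous h) (h0 : ∀ x, 0 ≤ h x) {c : ℝ}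
    (hc : ∀ x, (∑ i ∈ Finset.range Q, g (x + ((i : ℝ) / Q : ℝ))) / Q ≤ c) :
    ∫ x, g x * h (Q • x) ≤ c * ∫ x, h x := by
  rw [integral_mul_comp_nsmul hQ hg hh, ← integral_comp_nsmul hQ hh, ← integral_const_mul]
  refine integral_mono (integrable_of_continuous (by fun_prop))
    (integrable_of_continuous (by fun_prop)) fun x => ?_
  exact mul_le_mul_of_nonneg_right (hc x) (h0 _)

/-! ### Existence of the weak limit -/

theorem integral_fourier_mul_rieszPartial_succ (a : ℝ) (q N : ℕ) (m : ℤ) :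
    ∫ x : UnitAddCircle, fourier m x * (rieszPartial a q (N + 1) x : ℂ) =
      (∫ x : UnitAddCircle, fourier m x * (rieszPartial a q N x : ℂ))
      + a / 2 * (∫ x : UnitAddCircle, fourier (m + (q : ℤ) ^ N) x * (rieszPartial a q N x : ℂ))
      + a / 2 * (∫ x : UnitAddCircle, fourier (m - (q : ℤ) ^ N) x * (rieszPartial a q N x : ℂ)) := by
  have hc := continuous_rieszPartial a q N
  rw [← integral_const_mul, ← integral_const_mul, ← integral_add, ← integral_add]
  · congr 1
    ext x
    rw [rieszPartial_succ, sub_eq_add_neg, fourier_add, fourier_add, fourier_neg]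
    push_cast
    rw [Complex.re_eq_add_conj]
    ring
  all_goals exact integrable_of_continuous (by fun_prop)

/-- The spectrum of the `N`-th partial product lies in `(-q ^ N / 2, q ^ N / 2)`. -/
theorem integral_fourier_mul_rieszPartial_eq_zero (a : ℝ) {q : ℕ} (hq : 4 ≤ q) (N : ℕ) :
    ∀ m : ℤ, (q : ℤ) ^ N ≤ 2 * |m| →
      ∫ x : UnitAddCircle, fourier m x * (rieszPartial a q N x : ℂ) = 0 := by
  induction N with
  | zero =>
    intro m hm
    simp only [rieszPartial_zero, Complex.ofReal_one, mul_one]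
    have hm0 : m ≠ 0 := by
      rintro rfl
      simp at hm
    exact integral_eq_zero_of_add_right_eq_neg (fun x => fourier_add_half_inv_index hm0 one_pos x)
  | succ N ih =>
    intro m hm
    have hp : (0 : ℤ) ≤ (q : ℤ) ^ N := by positivity
    have h4 : 4 * (q : ℤ) ^ N ≤ 2 * |m| := by
      refine le_trans ?_ hm
      rw [pow_succ, mul_comm]
      exact mul_le_mul_of_nonneg_left (by exact_mod_cast hq) hp
    rw [integral_fourier_mul_rieszPartial_succ, ih m (by linarith), ih _ ?_, ih _ ?_]
    · simp
    all_goals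
      rcases abs_cases m with ⟨h, _⟩ | ⟨h, _⟩ <;>
      first
        | linarith [le_abs_self (m + (q : ℤ) ^ N), neg_le_abs (m + (q : ℤ) ^ N)]
        | linarith [le_abs_self (m - (q : ℤ) ^ N), neg_le_abs (m - (q : ℤ) ^ N)]

/-- The Fourier coefficients of the partial products are eventually constant. -/
theorem integral_fourier_mul_rieszPartial_stable (a : ℝ) {q : ℕ} (hq : 4 ≤ q) (m : ℤ) :
    ∃ N₀ : ℕ, ∀ N ≥ N₀, ∫ x : UnitAddCircle, fourier m x * (rieszPartial a q N x : ℂ) =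
      ∫ x : UnitAddCircle, fourier m x * (rieszPartial a q N₀ x : ℂ) := by
  refine ⟨2 * m.natAbs, fun N hN => ?_⟩
  induction N, hN using Nat.le_induction with
  | base => rfl
  | succ N hN ih =>
    have h1 : N < q ^ N := Nat.lt_pow_self (by omega)
    have h2 : 2 * |m| ≤ (q : ℤ) ^ N := by
      have : 2 * m.natAbs ≤ q ^ N := by omega
      have h3 : ((2 * m.natAbs : ℕ) : ℤ) ≤ ((q ^ N : ℕ) : ℤ) := by exact_mod_cast this
      simpa using h3
    rw [integral_fourier_mul_rieszPartial_succ, ih,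
      integral_fourier_mul_rieszPartial_eq_zero a hq N (m + (q : ℤ) ^ N) ?_,
      integral_fourier_mul_rieszPartial_eq_zero a hq N (m - (q : ℤ) ^ N) ?_]
    · simp
    all_goals
      rcases abs_cases m with ⟨h, _⟩ | ⟨h, _⟩ <;>
      first
        | linarith [le_abs_self (m + (q : ℤ) ^ N), neg_le_abs (m + (q : ℤ) ^ N)]
        | linarith [le_abs_self (m - (q : ℤ) ^ N), neg_le_abs (m - (q : ℤ) ^ N)]

theorem integral_rieszPartial (a : ℝ) {q : ℕ} (hq : 4 ≤ q) (N : ℕ) :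
    ∫ x : UnitAddCircle, rieszPartial a q N x = 1 := by
  induction N with
  | zero => simp [rieszPartial_zero, measureReal_def]
  | succ N ih =>
    have hp : (0 : ℤ) < (q : ℤ) ^ N := by positivity
    have h := integral_fourier_mul_rieszPartial_succ a q N 0
    rw [integral_fourier_mul_rieszPartial_eq_zero a hq N (0 + (q : ℤ) ^ N)
        (by rw [zero_add, abs_of_pos hp]; linarith),
      integral_fourier_mul_rieszPartial_eq_zero a hq N (0 - (q : ℤ) ^ N)
        (by rw [zero_sub, abs_neg, abs_of_pos hp]; linarith)] at h
    simp only [fourier_zero, one_mul, mul_zero, add_zero] at h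
    rw [integral_complex_ofReal, integral_complex_ofReal] at h
    rw [Complex.ofReal_injective h, ih]

theorem integral_rieszPartialMeasure {E : Type*} [NormedAddCommGroup E] [NormedSpace ℝ E]
    {a : ℝ} (ha : a ∈ Set.Icc (-1 : ℝ) 1) (q N : ℕ) (f : UnitAddCircle → E) :
    ∫ x, f x ∂(rieszPartialMeasure a q N : Measure UnitAddCircle) =
      ∫ x, rieszPartial a q N x • f x := by
  change ∫ x, f x ∂((volume : Measure UnitAddCircle).withDensity
    fun x => ENNReal.ofReal (rieszPartial a q N x)) = _
  have hm : Measurable fun x => Real.toNNReal (rieszPartial a q N x) :=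
    (continuous_rieszPartial a q N).measurable.real_toNNReal
  have := integral_withDensity_eq_integral_smul (μ := (volume : Measure UnitAddCircle)) hm f
  refine this.trans ?_
  congr 1
  ext x
  rw [NNReal.smul_def, Real.coe_toNNReal _ (rieszPartial_nonneg ha q N x)]

theorem isProbabilityMeasure_rieszPartialMeasure {a : ℝ} (ha : a ∈ Set.Icc (-1 : ℝ) 1) {q : ℕ}
    (hq : 4 ≤ q) (N : ℕ) :
    IsProbabilityMeasure (rieszPartialMeasure a q N : Measure UnitAddCircle) := by
  have h := integral_rieszPartialMeasure ha q N fun _ => (1 : ℝ)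
  simp only [smul_eq_mul, mul_one, integral_rieszPartial a hq N, integral_const] at h
  exact isProbabilityMeasure_iff_real.2 h

theorem lipschitzWith_integral (μ : Measure UnitAddCircle) [IsProbabilityMeasure μ] :
    LipschitzWith 1 fun f : C(UnitAddCircle, ℂ) => ∫ x, f x ∂μ := by
  refine LipschitzWith.of_dist_le_mul fun f g => ?_
  rw [dist_eq_norm, ← integral_sub (integrable_of_continuous f.continuous)
    (integrable_of_continuous g.continuous), NNReal.coe_one, one_mul, dist_eq_norm]
  refine (norm_integral_le_of_norm_le_const (C := ‖f - g‖) (.of_forall fun x => ?_)).trans ?_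
  · exact (f - g).norm_coe_le_norm x
  · simp

theorem eq_of_integral_fourier_eq {μ ν : ProbabilityMeasure UnitAddCircle}
    (h : ∀ m : ℤ, ∫ x, fourier m x ∂(μ : Measure UnitAddCircle) =
      ∫ x, fourier m x ∂(ν : Measure UnitAddCircle)) : μ = ν := by
  have hall : ∀ f : C(UnitAddCircle, ℂ), ∫ x, f x ∂(μ : Measure UnitAddCircle) =
      ∫ x, f x ∂(ν : Measure UnitAddCircle) := by
    intro f
    have hf : f ∈ (Submodule.span ℂ (Set.range (@fourier 1))).topologicalClosure := by
      rw [span_fourier_closure_eq_top]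
      trivial
    have hcl : IsClosed {f : C(UnitAddCircle, ℂ) | ∫ x, f x ∂(μ : Measure UnitAddCircle) =
        ∫ x, f x ∂(ν : Measure UnitAddCircle)} :=
      isClosed_eq (lipschitzWith_integral _).continuous (lipschitzWith_integral _).continuous
    refine closure_minimal (fun g hg => ?_) hcl hf
    refine Submodule.span_induction ?_ ?_ ?_ ?_ hg
    · rintro _ ⟨m, rfl⟩
      exact h m
    · simp
    · intro u v _ _ hu hv
      simp only [Set.mem_ofPred_eq, ContinuousMap.add_apply] at *
      rw [integral_add (integrable_of_continuous u.continuous)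
        (integrable_of_continuous v.continuous), hu, hv, integral_add
        (integrable_of_continuous u.continuous) (integrable_of_continuous v.continuous)]
    · intro c u _ hu
      simp only [Set.mem_ofPred_eq, ContinuousMap.smul_apply] at *
      rw [integral_smul, hu, integral_smul]
  refine Subtype.ext ?_
  have : IsFiniteMeasure (μ : Measure UnitAddCircle) := inferInstance
  have : IsFiniteMeasure (ν : Measure UnitAddCircle) := inferInstance
  refine ext_of_forall_integral_eq_of_IsFiniteMeasure (μ := (μ : Measure UnitAddCircle))
    (ν := (ν : Measure UnitAddCircle)) fun f => ?_
  have := hall ⟨fun x => (f x : ℂ), by fun_prop⟩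
  simp only [ContinuousMap.coe_mk] at this
  rw [integral_complex_ofReal, integral_complex_ofReal] at this
  exact Complex.ofReal_injective this

/-- By compactness of the space of probability measures, the partial products have a cluster
point; it is unique because its Fourier coefficients are the eventual values of theirs. -/
theorem tendsto_rieszPartialMeasure {a : ℝ} (ha : a ∈ Set.Icc (-1 : ℝ) 1) {q : ℕ} (hq : 4 ≤ q) :
    Tendsto (rieszPartialMeasure a q) atTop (𝓝 (rieszProduct a q)) := by
  let P : ℕ → ProbabilityMeasure UnitAddCircle := fun N =>
    ⟨rieszPartialMeasure a q N, isProbabilityMeasure_rieszPartialMeasure ha hq N⟩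
  obtain ⟨ν, -, hν⟩ := isCompact_univ (X := ProbabilityMeasure UnitAddCircle)
    (f := map P atTop) (by simp)
  have hcoef : ∀ ν' : ProbabilityMeasure UnitAddCircle, ClusterPt ν' (map P atTop) →
      ∀ m : ℤ, ∫ x, fourier m x ∂(ν' : Measure UnitAddCircle) =
        ∫ x : UnitAddCircle, fourier m x *
          (rieszPartial a q (integral_fourier_mul_rieszPartial_stable a hq m).choose x : ℂ) := by
    intro ν' hν' m
    have hN := (integral_fourier_mul_rieszPartial_stable a hq m).choose_spec
    set N₀ := (integral_fourier_mul_rieszPartial_stable a hq m).choose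
    have hcont : Continuous fun p : ProbabilityMeasure UnitAddCircle =>
        ∫ x, fourier m x ∂(p : Measure UnitAddCircle) := by
      have hre : ∀ g : C(UnitAddCircle, ℝ), Continuous fun p : ProbabilityMeasure UnitAddCircle =>
          ∫ x, g x ∂(p : Measure UnitAddCircle) := fun g =>
        continuous_iff_continuousAt.2 fun p =>
          ProbabilityMeasure.tendsto_iff_forall_integral_tendsto.1 tendsto_id
            (BoundedContinuousFunction.mkOfCompact g)
      have h1 := hre ⟨fun x => (fourier m x).re, by fun_prop⟩
      have h2 := hre ⟨fun x => (fourier m x).im, by fun_prop⟩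
      have h3 : (fun p : ProbabilityMeasure UnitAddCircle =>
          ∫ x, fourier m x ∂(p : Measure UnitAddCircle)) =
          fun p : ProbabilityMeasure UnitAddCircle =>
          ((∫ x, (fourier m x).re ∂(p : Measure UnitAddCircle) : ℝ) : ℂ) +
            ((∫ x, (fourier m x).im ∂(p : Measure UnitAddCircle) : ℝ) : ℂ) * Complex.I := by
        ext p
        exact (integral_re_add_im (integrable_of_continuous (by fun_prop))).symm
      rw [h3]
      simp only [ContinuousMap.coe_mk] at h1 h2
      fun_prop
    have hcl := hν'.map hcont.continuousAt tendsto_map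
    rw [map_map] at hcl
    have hev : ((fun p : ProbabilityMeasure UnitAddCircle =>
        ∫ x, fourier m x ∂(p : Measure UnitAddCircle)) ∘ P) =ᶠ[atTop]
        fun _ => ∫ x : UnitAddCircle, fourier m x * (rieszPartial a q N₀ x : ℂ) := by
      filter_upwards [eventually_ge_atTop N₀] with N hN'
      rw [← hN N hN']
      change ∫ x, fourier m x ∂(rieszPartialMeasure a q N : Measure UnitAddCircle) = _
      rw [integral_rieszPartialMeasure ha]
      congr 1
      ext x
      rw [Complex.real_smul, mul_comm]
    rw [Filter.map_congr hev] at hcl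
    rw [Filter.map_const] at hcl
    have : NeBot (𝓝 _ ⊓ 𝓝 _) := hcl.neBot.mono (inf_le_inf_left _ (pure_le_nhds _))
    exact eq_of_nhds_neBot this
  have hlim : Tendsto P atTop (𝓝 ν) := by
    refine le_nhds_of_unique_clusterPt fun ν' hν' => eq_of_integral_fourier_eq fun m => ?_
    rw [hcoef ν' hν' m, hcoef ν hν m]
  have hfin : Tendsto (rieszPartialMeasure a q) atTop (𝓝 ν.toFiniteMeasure) :=
    (ProbabilityMeasure.tendsto_nhds_iff_toFiniteMeasure_tendsto_nhds atTop).1 hlim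
  exact tendsto_nhds_limUnder ⟨_, hfin⟩

/-! ### The Fourier expansion of `log (1 + 2 r cos θ + r ^ 2)` -/

/-- The `n`-th cosine coefficient of `θ ↦ log (1 + 2 r cos θ + r ^ 2) = 2 log |1 + r e ^ (i θ)|`,
for `0 ≤ r < 1`; it vanishes for `n = 0`, by division by zero. -/
noncomputable def logCoeff (r : ℝ) (n : ℕ) : ℝ := 2 * (-1) ^ (n + 1) * r ^ n / n

@[simp] theorem logCoeff_zero (r : ℝ) : logCoeff r 0 = 0 := by simp [logCoeff]

theorem abs_logCoeff_le {r : ℝ} (hr : 0 ≤ r) (n : ℕ) : |logCoeff r n| ≤ 2 * r ^ n := by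
  rcases Nat.eq_zero_or_pos n with rfl | hn
  · simp
  have h1 : (1 : ℝ) ≤ n := by exact_mod_cast hn
  unfold logCoeff
  rw [abs_div, abs_mul, abs_mul, abs_pow, abs_neg, abs_one, one_pow, mul_one, abs_two,
    abs_of_nonneg (pow_nonneg hr n), Nat.abs_cast]
  exact div_le_self (by positivity) h1

theorem hasSum_logCoeff_mul_cos {r : ℝ} (hr : 0 ≤ r) (hr1 : r < 1) (θ : ℝ) :
    HasSum (fun n : ℕ => logCoeff r n * Real.cos (n * θ))
      (Real.log (1 + 2 * r * Real.cos θ + r ^ 2)) := by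
  set z : ℂ := r * Complex.exp (θ * Complex.I) with hz
  have hn : ‖z‖ < 1 := by
    rw [hz, norm_mul, Complex.norm_exp_ofReal_mul_I, mul_one, Complex.norm_real, Real.norm_eq_abs,
      abs_of_nonneg hr]
    exact hr1
  have h := ((Complex.hasSum_taylorSeries_log hn).mapL Complex.reCLM).mul_left 2
  have hval : 2 * Complex.reCLM (Complex.log (1 + z)) =
      Real.log (1 + 2 * r * Real.cos θ + r ^ 2) := by
    have hsq : 1 + 2 * r * Real.cos θ + r ^ 2 = ‖1 + z‖ ^ 2 := by
      rw [← Complex.normSq_eq_norm_sq, Complex.normSq_apply]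
      simp only [hz, Complex.add_re, Complex.add_im, Complex.one_re, Complex.one_im,
        Complex.re_ofReal_mul, Complex.im_ofReal_mul, Complex.exp_ofReal_mul_I_re,
        Complex.exp_ofReal_mul_I_im]
      nlinarith [Real.sin_sq_add_cos_sq θ]
    rw [hsq, Real.log_pow, Complex.reCLM_apply, Complex.log_re]
    norm_num
  rw [hval] at h
  refine h.congr_fun ?_
  intro n
  have hzn : z ^ n = ((r ^ n : ℝ) : ℂ) * Complex.exp (((n * θ : ℝ) : ℂ) * Complex.I) := by
    rw [hz, mul_pow, ← Complex.exp_nat_mul]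
    push_cast
    ring_nf
  have h2 : (-1 : ℂ) ^ (n + 1) * z ^ n / n =
      (((-1) ^ (n + 1) * r ^ n / n : ℝ) : ℂ) * Complex.exp (((n * θ : ℝ) : ℂ) * Complex.I) := by
    rw [hzn]
    push_cast
    ring
  rw [h2, Complex.reCLM_apply, Complex.re_ofReal_mul, Complex.exp_ofReal_mul_I_re, logCoeff]
  ring

/-- The cosine coefficients of `(1 + cos θ) log (1 + 2 r cos θ + r ^ 2)`. The truncated
subtraction at `n = 0` is harmless since `logCoeff r 0 = 0`. -/
noncomputable def weightedLogCoeff (r : ℝ) (n : ℕ) : ℝ :=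
  logCoeff r n + (logCoeff r (n + 1) + logCoeff r (n - 1)) / 2

theorem hasSum_weightedLogCoeff_mul_cos {r : ℝ} (hr : 0 ≤ r) (hr1 : r < 1) (θ : ℝ) :
    HasSum (fun n : ℕ => weightedLogCoeff r n * Real.cos (n * θ))
      ((1 + Real.cos θ) * Real.log (1 + 2 * r * Real.cos θ + r ^ 2)) := by
  have hsum : ∀ x : ℕ → ℝ, Summable fun n : ℕ => logCoeff r n * Real.cos (x n) := fun x => by
    refine Summable.of_norm_bounded ((summable_geometric_of_lt_one hr hr1).mul_left 2) fun n => ?_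
    rw [Real.norm_eq_abs, abs_mul]
    exact (mul_le_of_le_one_right (abs_nonneg _) (Real.abs_cos_le_one _)).trans
      (abs_logCoeff_le hr n)
  have h0 := hasSum_logCoeff_mul_cos hr hr1 θ
  have hu := (hsum fun n => (n + 1) * θ).hasSum
  have hv := (hsum fun n => (n - 1) * θ).hasSum
  set U := ∑' n : ℕ, logCoeff r n * Real.cos ((n + 1) * θ)
  set V := ∑' n : ℕ, logCoeff r n * Real.cos ((n - 1) * θ)
  have huv : (U + V) / 2 = Real.cos θ * Real.log (1 + 2 * r * Real.cos θ + r ^ 2) := by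
    refine ((hu.add hv).div_const 2).unique ((h0.mul_left (Real.cos θ)).congr_fun fun n => ?_)
    rw [add_mul, sub_mul, one_mul, Real.cos_add, Real.cos_sub]
    ring
  have hu' : HasSum (fun n : ℕ => logCoeff r (n - 1) * Real.cos (n * θ)) U := by
    rw [← hasSum_nat_add_iff' 1]
    simpa using hu
  have hv' : HasSum (fun n : ℕ => logCoeff r (n + 1) * Real.cos (n * θ)) V := by
    rw [← hasSum_nat_add_iff' 1] at hv
    simpa using hv
  have := h0.add ((hv'.add hu').div_const 2)
  rw [add_comm V, huv] at this
  convert this using 1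
  · ext n
    rw [weightedLogCoeff]
    ring
  · ring

theorem weightedLogCoeff_zero (r : ℝ) : weightedLogCoeff r 0 = r := by
  simp [weightedLogCoeff, logCoeff]

/-- For even `n ≥ 2` the coefficient is `2 ∫_0^r t ^ (n - 2) (1 - t) ^ 2 dt`. -/
theorem weightedLogCoeff_mem_Icc {r : ℝ} (hr : 0 ≤ r) (hr1 : r ≤ 1) {n : ℕ} (hn : Even n)
    (hn0 : n ≠ 0) :
    weightedLogCoeff r n ∈ Set.Icc 0 (2 / (n * ((n : ℝ) ^ 2 - 1))) := by
  obtain ⟨m, rfl⟩ : ∃ m, n = m + 2 := by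
    obtain ⟨k, rfl⟩ := hn
    exact ⟨k + k - 2, by omega⟩
  have hm : Even m := by simpa [Nat.even_add] using hn
  have hform : ∀ x : ℝ, weightedLogCoeff x (m + 2) =
      x ^ (m + 1) / (m + 1) + x ^ (m + 3) / (m + 3) - 2 * x ^ (m + 2) / (m + 2) := by
    intro x
    have h1 : (-1 : ℝ) ^ m = 1 := hm.neg_one_pow
    simp only [weightedLogCoeff, logCoeff, pow_succ, h1,
      show m + 2 - 1 = m + 1 by omega]
    push_cast
    ring
  have hder : ∀ x : ℝ, HasDerivAt
      (fun x : ℝ => x ^ (m + 1) / ((m : ℝ) + 1) + x ^ (m + 3) / ((m : ℝ) + 3)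
        - 2 * x ^ (m + 2) / ((m : ℝ) + 2)) (x ^ m * (1 - x) ^ 2) x := by
    intro x
    have h1 := (hasDerivAt_pow (m + 1) x).div_const ((m : ℝ) + 1)
    have h2 := (hasDerivAt_pow (m + 3) x).div_const ((m : ℝ) + 3)
    have h3 := ((hasDerivAt_pow (m + 2) x).const_mul 2).div_const ((m : ℝ) + 2)
    refine ((h1.add h2).sub h3).congr_deriv ?_
    push_cast
    field_simp
    ring
  have hmono := monotone_of_deriv_nonneg (fun x => (hder x).differentiableAt) fun x => by
    rw [(hder x).deriv]
    exact mul_nonneg (hm.pow_nonneg x) (sq_nonneg _)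
  constructor
  · rw [hform]
    simpa using hmono hr
  · rw [hform]
    refine (hmono hr1).trans (le_of_eq ?_)
    have h3 : ((m : ℝ) + 2) ^ 2 - 1 ≠ 0 := by nlinarith [(m.cast_nonneg : (0 : ℝ) ≤ m)]
    simp only [one_pow]
    push_cast
    rw [show ((m : ℝ) + 2) ^ 2 - 1 = (m + 1) * (m + 3) by ring]
    field_simp
    ring

/-! ### Averages over the cosets of `ℤ / q` -/

theorem sum_cos_eq_zero {q n : ℕ} (hq : q ≠ 0) (hn : ¬ q ∣ n) (t : ℝ) :
    ∑ i ∈ Finset.range q, Real.cos (n * (2 * Real.pi * (t + i / q))) = 0 := by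
  have hq' : (q : ℂ) ≠ 0 := Nat.cast_ne_zero.2 hq
  have hζ := Complex.isPrimitiveRoot_exp q hq
  set ζ := Complex.exp (2 * Real.pi * Complex.I / q) with hζ_def
  have hne : ζ ^ n ≠ 1 := fun h => hn (hζ.dvd_of_pow_eq_one n h)
  have hg : ∑ i ∈ Finset.range q, (ζ ^ n) ^ i = 0 := by
    have := mul_neg_geom_sum (ζ ^ n) q
    rw [← pow_mul, mul_comm n q, pow_mul, hζ.pow_eq_one, one_pow, sub_self] at this
    exact (mul_eq_zero.1 this).resolve_left (sub_ne_zero.2 hne.symm)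
  have : ∀ i ∈ Finset.range q, Real.cos (n * (2 * Real.pi * (t + i / q))) =
      (Complex.exp (((n * (2 * Real.pi * t) : ℝ) : ℂ) * Complex.I) * (ζ ^ n) ^ i).re := by
    intro i _
    rw [← Complex.exp_ofReal_mul_I_re, hζ_def, ← Complex.exp_nat_mul, ← Complex.exp_nat_mul,
      ← Complex.exp_add]
    congr 2
    push_cast
    field_simp
  rw [Finset.sum_congr rfl this, ← Complex.re_sum, ← Finset.mul_sum, hg]
  simp

theorem avg_weighted_log_le {q : ℕ} (hq : 4 ≤ q) (hq_even : Even q) {r : ℝ} (hr : 0 ≤ r)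
    (hr1 : r < 1) (t : ℝ) :
    (∑ i ∈ Finset.range q, (1 + Real.cos (2 * Real.pi * (t + i / q))) *
        Real.log (1 + 2 * r * Real.cos (2 * Real.pi * (t + i / q)) + r ^ 2)) / q
      ≤ r + 2 / (q * ((q : ℝ) ^ 2 - 1)) * (Real.pi ^ 2 / 6) := by
  have hq4 : (4 : ℝ) ≤ q := by exact_mod_cast hq
  set A : ℕ → ℝ := fun n =>
    (∑ i ∈ Finset.range q, Real.cos (n * (2 * Real.pi * (t + i / q)))) / q with hA
  have hA1 : ∀ n, A n ≤ 1 := fun n => by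
    rw [hA, div_le_one (by linarith)]
    refine (Finset.sum_le_sum fun i _ => Real.cos_le_one _).trans ?_
    simp
  have hsum := (hasSum_sum (s := Finset.range q) fun i _ =>
    hasSum_weightedLogCoeff_mul_cos hr hr1 (2 * Real.pi * (t + i / q))).div_const (q : ℝ)
  have hsum' : HasSum (fun n => weightedLogCoeff r n * A n) _ := hsum.congr_fun fun n => by
    rw [hA, ← Finset.mul_sum, mul_div_assoc]
  have hinj : Function.Injective fun k : ℕ => q * k := fun a b h =>
    Nat.eq_of_mul_eq_mul_left (by omega) h
  rw [← hinj.hasSum_iff] at hsum'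
  swap
  · intro n hn
    have hn' : ¬ q ∣ n := fun ⟨k, hk⟩ => hn ⟨k, hk.symm⟩
    simp only [hA]
    rw [sum_cos_eq_zero (by omega) hn', zero_div, mul_zero]
  have hbound := (hasSum_ite_eq (0 : ℕ) r).add
    (hasSum_zeta_two.mul_left (2 / (q * ((q : ℝ) ^ 2 - 1))))
  refine hasSum_le (fun k => ?_) hsum' hbound
  rcases Nat.eq_zero_or_pos k with rfl | hk
  · simpa [weightedLogCoeff_zero] using mul_le_of_le_one_right hr (hA1 0)
  · have hk1 : (1 : ℝ) ≤ k := by exact_mod_cast hk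
    obtain ⟨h0, h1⟩ := weightedLogCoeff_mem_Icc hr hr1.le (hq_even.mul_right k)
      (Nat.mul_ne_zero (by omega) hk.ne')
    refine (mul_le_of_le_one_right h0 (hA1 _)).trans (h1.trans ?_)
    rw [if_neg hk.ne', zero_add, div_mul_div_comm, mul_one]
    push_cast
    have hq2 : (0 : ℝ) < (q : ℝ) ^ 2 - 1 := by nlinarith
    refine div_le_div_of_nonneg_left (by norm_num) (by positivity) ?_
    have h3 : (k : ℝ) * ((q : ℝ) ^ 2 - 1) ≤ ((q : ℝ) * k) ^ 2 - 1 := by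
      have : (q : ℝ) ^ 2 * k * (k - 1) ≥ 0 := by
        have : (0 : ℝ) ≤ k - 1 := by linarith
        positivity
      nlinarith
    calc (q : ℝ) * ((q : ℝ) ^ 2 - 1) * (k : ℝ) ^ 2 = q * k * (k * ((q : ℝ) ^ 2 - 1)) := by ring
      _ ≤ _ := by gcongr

/-- The bound `1 - log 2 + π ^ 2 / (3 q (q ^ 2 - 1))` for the averages of
`(1 + a cos θ) log (1 + a cos θ)` over the translates of the `q`-th roots of unity. -/
noncomputable def entropyBound (q : ℕ) : ℝ :=
  1 - Real.log 2 + 2 / (q * ((q : ℝ) ^ 2 - 1)) * (Real.pi ^ 2 / 6)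

theorem avg_entropy_one_le {q : ℕ} (hq : 4 ≤ q) (hq_even : Even q) (t : ℝ) :
    (∑ i ∈ Finset.range q, (1 + Real.cos (2 * Real.pi * (t + i / q))) *
        Real.log (1 + Real.cos (2 * Real.pi * (t + i / q)))) / q ≤ entropyBound q := by
  have hq0 : (q : ℝ) ≠ 0 := Nat.cast_ne_zero.2 (by omega)
  have hlim : Tendsto (fun r : ℝ => (∑ i ∈ Finset.range q,
      (1 + Real.cos (2 * Real.pi * (t + i / q))) *
        Real.log (1 + 2 * r * Real.cos (2 * Real.pi * (t + i / q)) + r ^ 2)) / q) (𝓝[<] 1)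
      (𝓝 ((∑ i ∈ Finset.range q, (1 + Real.cos (2 * Real.pi * (t + i / q))) *
        Real.log (2 * (1 + Real.cos (2 * Real.pi * (t + i / q))))) / q)) := by
    refine Tendsto.div_const (tendsto_finsetSum _ fun i _ => ?_) _
    set c := Real.cos (2 * Real.pi * (t + i / q))
    by_cases hc : 1 + c = 0
    · simp [hc]
    · refine tendsto_nhdsWithin_of_tendsto_nhds (Tendsto.const_mul _ ?_)
      have h2 : Tendsto (fun r : ℝ => 1 + 2 * r * c + r ^ 2) (𝓝 1) (𝓝 (2 * (1 + c))) := by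
        have : Continuous fun r : ℝ => 1 + 2 * r * c + r ^ 2 := by fun_prop
        convert this.tendsto 1 using 2
        ring
      exact h2.log (by simpa using hc)
  have hlim2 : Tendsto (fun r : ℝ => r + 2 / (q * ((q : ℝ) ^ 2 - 1)) * (Real.pi ^ 2 / 6)) (𝓝[<] 1)
      (𝓝 (1 + 2 / (q * ((q : ℝ) ^ 2 - 1)) * (Real.pi ^ 2 / 6))) :=
    tendsto_nhdsWithin_of_tendsto_nhds (tendsto_id.add_const _)
  have hle := le_of_tendsto_of_tendsto hlim hlim2 (by
    filter_upwards [Ioo_mem_nhdsLT (zero_lt_one' ℝ)] with r hr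
    exact avg_weighted_log_le hq hq_even hr.1.le hr.2 t)
  have hcos : ∑ i ∈ Finset.range q, Real.cos (2 * Real.pi * (t + i / q)) = 0 := by
    simpa using sum_cos_eq_zero (q := q) (n := 1) (by omega)
      (fun h => by have := Nat.le_of_dvd one_pos h; omega) t
  have hsplit : ∀ c : ℝ, (1 + c) * Real.log (2 * (1 + c)) =
      (1 + c) * Real.log (1 + c) + (1 + c) * Real.log 2 := by
    intro c
    by_cases hc : 1 + c = 0
    · simp [hc]
    · rw [Real.log_mul two_ne_zero hc]
      ring
  simp_rw [hsplit] at hle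
  rw [Finset.sum_add_distrib, ← Finset.sum_mul, Finset.sum_add_distrib, hcos] at hle
  simp only [Finset.sum_const, Finset.card_range, nsmul_eq_mul, mul_one, add_zero] at hle
  rw [add_div, mul_div_cancel_left₀ _ hq0] at hle
  unfold entropyBound
  linarith

/-- The entropy average is convex and even in `a`, hence largest at `a = 1`. -/
theorem avg_entropy_le {q : ℕ} (hq : 4 ≤ q) (hq_even : Even q) {a : ℝ}
    (ha : a ∈ Set.Icc (-1 : ℝ) 1) (t : ℝ) :
    (∑ i ∈ Finset.range q, (1 + a * Real.cos (2 * Real.pi * (t + i / q))) *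
        Real.log (1 + a * Real.cos (2 * Real.pi * (t + i / q)))) / q ≤ entropyBound q := by
  have h1 := avg_entropy_one_le hq hq_even t
  have h2 := avg_entropy_one_le hq hq_even (t + 1 / 2)
  have hshift : ∀ i : ℕ, Real.cos (2 * Real.pi * (t + 1 / 2 + i / q)) =
      -Real.cos (2 * Real.pi * (t + i / q)) := fun i => by
    rw [← Real.cos_add_pi]
    congr 1
    ring
  simp_rw [hshift] at h2
  have hconv : ∀ c : ℝ, c ∈ Set.Icc (-1 : ℝ) 1 → (1 + a * c) * Real.log (1 + a * c) ≤
      (1 + a) / 2 * ((1 + c) * Real.log (1 + c)) + (1 - a) / 2 * ((1 + -c) * Real.log (1 + -c)) := by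
    intro c hc
    have := Real.convexOn_mul_log.2
      (show 1 + c ∈ Set.Ici (0 : ℝ) from Set.mem_Ici.2 (by linarith [hc.1]))
      (show 1 + -c ∈ Set.Ici (0 : ℝ) from Set.mem_Ici.2 (by linarith [hc.2]))
      (show 0 ≤ (1 + a) / 2 by linarith [ha.1]) (show 0 ≤ (1 - a) / 2 by linarith [ha.2]) (by ring)
    simp only [smul_eq_mul] at this
    rwa [show (1 + a) / 2 * (1 + c) + (1 - a) / 2 * (1 + -c) = 1 + a * c by ring] at this
  have h3 := Finset.sum_le_sum (s := Finset.range q) fun i _ =>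
    hconv (Real.cos (2 * Real.pi * (t + i / q))) (Real.cos_mem_Icc _)
  rw [Finset.sum_add_distrib, ← Finset.mul_sum, ← Finset.mul_sum] at h3
  have h4 := div_le_div_of_nonneg_right h3 (Nat.cast_nonneg q : (0 : ℝ) ≤ q)
  rw [add_div, mul_div_assoc, mul_div_assoc] at h4
  refine h4.trans ?_
  have h5 := mul_le_mul_of_nonneg_left h1 (show 0 ≤ (1 + a) / 2 by linarith [ha.1])
  have h6 := mul_le_mul_of_nonneg_left h2 (show 0 ≤ (1 - a) / 2 by linarith [ha.2])
  linarith

/-! ### The integral `∫ log (cos ^ 2 z) sin (2 z / q)` -/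

theorem intervalIntegrable_log_cos_sq (x y : ℝ) :
    IntervalIntegrable (fun z : ℝ => Real.log (Real.cos z ^ 2)) volume x y := by
  have h : (fun z : ℝ => Real.log (Real.cos z ^ 2)) = fun z => 2 * (Real.log ∘ Real.cos) z := by
    ext z
    rw [Real.log_pow]
    norm_num
  rw [h]
  exact intervalIntegrable_log_cos.const_mul 2

theorem intervalIntegrable_log_cos_sq_mul_sin (q : ℕ) (x y : ℝ) :
    IntervalIntegrable (fun z : ℝ => Real.log (Real.cos z ^ 2) * Real.sin (2 * z / q))
      volume x y :=
  (intervalIntegrable_log_cos_sq x y).mul_continuousOn (by fun_prop)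

theorem cos_pi_div_pos {q : ℕ} (hq : 4 ≤ q) : 0 < Real.cos (Real.pi / q) := by
  have hq4 : (4 : ℝ) ≤ q := by exact_mod_cast hq
  have h0 : 0 ≤ Real.pi / q := div_nonneg Real.pi_pos.le (by linarith)
  have h1 : Real.pi / q < Real.pi / 2 :=
    div_lt_div_of_pos_left Real.pi_pos two_pos (by linarith)
  exact Real.cos_pos_of_mem_Ioo ⟨by linarith [Real.pi_pos], h1⟩

/-- Both antiderivative terms vanish at `q π / 4`, because `q` is even. -/
theorem integral_cos_mul_sin {q : ℕ} (hq : 4 ≤ q) (hq_even : Even q) {n : ℕ} (hn : n ≠ 0) :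
    ∫ z in (Real.pi / 2)..(q * Real.pi / 4), Real.cos (n * (2 * z)) * Real.sin (2 * z / q) =
      -((-1) ^ n * Real.cos (Real.pi / q) * q / (2 * (((q : ℝ) * n) ^ 2 - 1))) := by
  have hq4 : (4 : ℝ) ≤ q := by exact_mod_cast hq
  have hn1 : (1 : ℝ) ≤ n := by exact_mod_cast Nat.one_le_iff_ne_zero.2 hn
  have hq0 : (q : ℝ) ≠ 0 := by linarith
  have hqn : 4 ≤ (q : ℝ) * n := by nlinarith
  have hp : (q : ℝ) * n + 1 ≠ 0 := by linarith
  have hm : (q : ℝ) * n - 1 ≠ 0 := by linarith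
  set α : ℝ := 2 * (q * n + 1) / q with hα
  set β : ℝ := 2 * (q * n - 1) / q with hβ
  have hα0 : α ≠ 0 := div_ne_zero (mul_ne_zero two_ne_zero hp) hq0
  have hβ0 : β ≠ 0 := div_ne_zero (mul_ne_zero two_ne_zero hm) hq0
  have hderiv : ∀ z ∈ Set.uIcc (Real.pi / 2) (q * Real.pi / 4),
      HasDerivAt (fun z => (Real.cos (β * z) / β - Real.cos (α * z) / α) / 2)
        (Real.cos (n * (2 * z)) * Real.sin (2 * z / q)) z := by
    intro z _
    have h1 := (((hasDerivAt_id z).const_mul α).cos).div_const α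
    have h2 := (((hasDerivAt_id z).const_mul β).cos).div_const β
    refine ((h2.sub h1).div_const 2).congr_deriv ?_
    have e1 : α * z = n * (2 * z) + 2 * z / q := by rw [hα]; field_simp
    have e2 : β * z = n * (2 * z) - 2 * z / q := by rw [hβ]; field_simp
    simp only [id, mul_one]
    rw [mul_div_cancel_right₀ _ hα0, mul_div_cancel_right₀ _ hβ0, e1, e2, Real.sin_add,
      Real.sin_sub]
    ring
  rw [intervalIntegral.integral_eq_sub_of_hasDerivAt hderiv
    (Continuous.intervalIntegrable (by fun_prop) _ _)]
  obtain ⟨p, rfl⟩ := hq_even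
  have hp0 : (p : ℝ) ≠ 0 := by
    intro h
    simp [h] at hq0
  have e1 : Real.cos (α * (((p + p : ℕ) : ℝ) * Real.pi / 4)) = 0 := by
    have : α * (((p + p : ℕ) : ℝ) * Real.pi / 4) = Real.pi / 2 + ((n * p : ℕ) : ℝ) * Real.pi := by
      rw [hα]
      push_cast
      field_simp
      ring
    rw [this, Real.cos_add_nat_mul_pi, Real.cos_pi_div_two, mul_zero]
  have e2 : Real.cos (β * (((p + p : ℕ) : ℝ) * Real.pi / 4)) = 0 := by
    have : β * (((p + p : ℕ) : ℝ) * Real.pi / 4) =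
        -(Real.pi / 2) + ((n * p : ℕ) : ℝ) * Real.pi := by
      rw [hβ]
      push_cast
      field_simp
      ring
    rw [this, Real.cos_add_nat_mul_pi, Real.cos_neg, Real.cos_pi_div_two, mul_zero]
  have e3 : Real.cos (α * (Real.pi / 2)) = (-1) ^ n * Real.cos (Real.pi / ((p + p : ℕ) : ℝ)) := by
    have : α * (Real.pi / 2) = Real.pi / ((p + p : ℕ) : ℝ) + (n : ℝ) * Real.pi := by
      rw [hα]
      field_simp
      ring
    rw [this, Real.cos_add_nat_mul_pi]
  have e4 : Real.cos (β * (Real.pi / 2)) = (-1) ^ n * Real.cos (Real.pi / ((p + p : ℕ) : ℝ)) := by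
    have : β * (Real.pi / 2) = -(Real.pi / ((p + p : ℕ) : ℝ)) + (n : ℝ) * Real.pi := by
      rw [hβ]
      field_simp
      ring
    rw [this, Real.cos_add_nat_mul_pi, Real.cos_neg]
  rw [e1, e2, e3, e4, hα, hβ,
    show (((p + p : ℕ) : ℝ) * n) ^ 2 - 1 = (((p + p : ℕ) : ℝ) * n + 1) * (((p + p : ℕ) : ℝ) * n - 1)
      by ring]
  field_simp
  ring

theorem integral_log_one_add_mul_sin_mem_Icc {q : ℕ} (hq : 4 ≤ q) (hq_even : Even q) {r : ℝ}
    (hr : 0 ≤ r) (hr1 : r < 1) :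
    ∫ z in (Real.pi / 2)..(q * Real.pi / 4),
      Real.log (1 + 2 * r * Real.cos (2 * z) + r ^ 2) * Real.sin (2 * z / q) ∈
      Set.Icc 0 (Real.cos (Real.pi / q) * q / ((q : ℝ) ^ 2 - 1) * (Real.pi ^ 2 / 6)) := by
  have hq4 : (4 : ℝ) ≤ q := by exact_mod_cast hq
  have hcos := cos_pi_div_pos hq
  have hsum : HasSum (fun n : ℕ => ∫ z in (Real.pi / 2)..(q * Real.pi / 4),
      logCoeff r n * Real.cos (n * (2 * z)) * Real.sin (2 * z / q))
      (∫ z in (Real.pi / 2)..(q * Real.pi / 4),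
        Real.log (1 + 2 * r * Real.cos (2 * z) + r ^ 2) * Real.sin (2 * z / q)) := by
    refine intervalIntegral.hasSum_integral_of_dominated_convergence
      (fun n _ => 2 * r ^ n) (fun n => Continuous.aestronglyMeasurable (by fun_prop))
      (fun n => .of_forall fun z _ => ?_)
      (.of_forall fun z _ => (summable_geometric_of_lt_one hr hr1).mul_left 2)
      intervalIntegrable_const (.of_forall fun z _ => ?_)
    · rw [Real.norm_eq_abs, abs_mul, abs_mul, mul_assoc]
      refine (mul_le_of_le_one_right (abs_nonneg _) ?_).trans (abs_logCoeff_le hr n)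
      exact mul_le_one₀ (Real.abs_cos_le_one _) (abs_nonneg _) (Real.abs_sin_le_one _)
    · exact (hasSum_logCoeff_mul_cos hr hr1 (2 * z)).mul_right _
  have hterm : ∀ n : ℕ, ∫ z in (Real.pi / 2)..(q * Real.pi / 4),
      logCoeff r n * Real.cos (n * (2 * z)) * Real.sin (2 * z / q) =
        r ^ n * (Real.cos (Real.pi / q) * q / (n * (((q : ℝ) * n) ^ 2 - 1))) := by
    intro n
    rcases Nat.eq_zero_or_pos n with rfl | hn
    · simp
    simp_rw [mul_assoc]
    rw [intervalIntegral.integral_const_mul, integral_cos_mul_sin hq hq_even hn.ne', logCoeff]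
    have h1 : (-1 : ℝ) ^ n * (-1) ^ n = 1 := by rw [← mul_pow]; simp
    rw [pow_succ]
    generalize ((q : ℝ) * n) ^ 2 - 1 = D
    linear_combination (r ^ n * Real.cos (Real.pi / q) * q / (n * D)) * h1
  simp_rw [hterm] at hsum
  have hpos : ∀ n : ℕ, 0 ≤ Real.cos (Real.pi / q) * q / (n * (((q : ℝ) * n) ^ 2 - 1)) ∧
      Real.cos (Real.pi / q) * q / (n * (((q : ℝ) * n) ^ 2 - 1)) ≤
        Real.cos (Real.pi / q) * q / ((q : ℝ) ^ 2 - 1) * (1 / (n : ℝ) ^ 2) := by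
    intro n
    rcases Nat.eq_zero_or_pos n with rfl | hn
    · simp
    have hn1 : (1 : ℝ) ≤ n := by exact_mod_cast hn
    have hq2 : (0 : ℝ) < (q : ℝ) ^ 2 - 1 := by nlinarith
    have h3 : (n : ℝ) * ((q : ℝ) ^ 2 - 1) ≤ ((q : ℝ) * n) ^ 2 - 1 := by
      have : (q : ℝ) ^ 2 * n * (n - 1) ≥ 0 := by
        have : (0 : ℝ) ≤ n - 1 := by linarith
        positivity
      nlinarith
    have h4 : 0 < ((q : ℝ) * n) ^ 2 - 1 := lt_of_lt_of_le (by positivity) h3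
    refine ⟨by positivity, ?_⟩
    rw [div_mul_div_comm, mul_one]
    refine div_le_div_of_nonneg_left (by positivity) (by positivity) ?_
    calc ((q : ℝ) ^ 2 - 1) * (n : ℝ) ^ 2 = n * (n * ((q : ℝ) ^ 2 - 1)) := by ring
      _ ≤ _ := by gcongr
  refine ⟨hsum.nonneg fun n => mul_nonneg (pow_nonneg hr n) (hpos n).1, ?_⟩
  refine hasSum_le (fun n => ?_) hsum
    (hasSum_zeta_two.mul_left (Real.cos (Real.pi / q) * q / ((q : ℝ) ^ 2 - 1)))
  exact (mul_le_of_le_one_left (hpos n).1 (pow_le_one₀ hr hr1.le)).trans (hpos n).2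

theorem ae_cos_ne_zero : ∀ᵐ z : ℝ, Real.cos z ≠ 0 := by
  have hc : {z : ℝ | Real.cos z = 0}.Countable := by
    refine (Set.countable_range fun k : ℤ => (2 * (k : ℝ) + 1) * Real.pi / 2).mono fun z hz => ?_
    obtain ⟨k, hk⟩ := Real.cos_eq_zero_iff.1 hz
    exact ⟨k, hk.symm⟩
  exact hc.ae_notMem volume

/-- Dominated convergence: `cos ^ 2 z ≤ 1 + 2 r cos (2 z) + r ^ 2 ≤ 4` for `1 / 2 ≤ r < 1`. -/
theorem tendsto_integral_log_one_add_mul_sin (q : ℕ) (x y : ℝ) :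
    Tendsto (fun r : ℝ => ∫ z in x..y,
      Real.log (1 + 2 * r * Real.cos (2 * z) + r ^ 2) * Real.sin (2 * z / q)) (𝓝[<] 1)
      (𝓝 (∫ z in x..y, Real.log (4 * Real.cos z ^ 2) * Real.sin (2 * z / q))) := by
  refine intervalIntegral.tendsto_integral_filter_of_dominated_convergence
    (fun z => Real.log 4 + |Real.log (Real.cos z ^ 2)|) ?_ ?_ ?_ ?_
  · refine .of_forall fun r => Measurable.aestronglyMeasurable ?_
    fun_prop
  · filter_upwards [Ico_mem_nhdsLT (show (1 / 2 : ℝ) < 1 by norm_num)] with r hr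
    filter_upwards [ae_cos_ne_zero] with z hz _
    rw [norm_mul]
    refine (mul_le_of_le_one_right (norm_nonneg _) (Real.abs_sin_le_one _)).trans ?_
    have hc2 : 0 < Real.cos z ^ 2 := by positivity
    have hc1 : Real.cos z ^ 2 ≤ 1 := Real.cos_sq_le_one z
    have hlow : Real.cos z ^ 2 ≤ 1 + 2 * r * Real.cos (2 * z) + r ^ 2 := by
      rw [Real.cos_two_mul]
      nlinarith [sq_nonneg (1 - r), mul_le_mul_of_nonneg_right hr.1 hc2.le]
    have hup : 1 + 2 * r * Real.cos (2 * z) + r ^ 2 ≤ 4 := by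
      rw [Real.cos_two_mul]
      nlinarith [hr.1, hr.2, mul_le_mul_of_nonneg_left hc1 (show 0 ≤ r by linarith [hr.1])]
    have h1 := Real.log_le_log hc2 hlow
    have h2 := Real.log_le_log (hc2.trans_le hlow) hup
    have h4 : 0 ≤ Real.log 4 := Real.log_nonneg (by norm_num)
    rw [Real.norm_eq_abs, abs_le]
    constructor
    · linarith [neg_abs_le (Real.log (Real.cos z ^ 2))]
    · linarith [abs_nonneg (Real.log (Real.cos z ^ 2))]
  · exact intervalIntegrable_const.add (intervalIntegrable_log_cos_sq x y).abs
  · filter_upwards [ae_cos_ne_zero] with z hz _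
    refine Tendsto.mul_const _ (tendsto_nhdsWithin_of_tendsto_nhds ?_)
    have h2 : Tendsto (fun r : ℝ => 1 + 2 * r * Real.cos (2 * z) + r ^ 2) (𝓝 1)
        (𝓝 (4 * Real.cos z ^ 2)) := by
      have : Continuous fun r : ℝ => 1 + 2 * r * Real.cos (2 * z) + r ^ 2 := by fun_prop
      convert this.tendsto 1 using 2
      rw [Real.cos_two_mul]
      ring
    exact h2.log (by positivity)

theorem integral_log_four_cos_sq_mul_sin {q : ℕ} (hq : q ≠ 0) :
    ∫ z in (Real.pi / 2)..(q * Real.pi / 4), Real.log (4 * Real.cos z ^ 2) * Real.sin (2 * z / q) =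
      q * Real.log 2 * Real.cos (Real.pi / q) + rieszIntegral q := by
  have hq0 : (q : ℝ) ≠ 0 := Nat.cast_ne_zero.2 hq
  have hsplit : ∀ᵐ z : ℝ, z ∈ Set.uIoc (Real.pi / 2) (q * Real.pi / 4) →
      Real.log (4 * Real.cos z ^ 2) * Real.sin (2 * z / q) =
        Real.log 4 * Real.sin (2 * z / q) + Real.log (Real.cos z ^ 2) * Real.sin (2 * z / q) := by
    filter_upwards [ae_cos_ne_zero] with z hz _
    rw [Real.log_mul (by norm_num) (by positivity)]
    ring
  have hsin : ∫ z in (Real.pi / 2)..(q * Real.pi / 4), Real.sin (2 * z / q) =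
      q / 2 * Real.cos (Real.pi / q) := by
    have hd : ∀ z ∈ Set.uIcc (Real.pi / 2) (q * Real.pi / 4),
        HasDerivAt (fun z : ℝ => -(q / 2 * Real.cos (2 * z / q))) (Real.sin (2 * z / q)) z := by
      intro z _
      have h1 := ((((hasDerivAt_id z).const_mul 2).div_const (q : ℝ)).cos.const_mul (q / 2 : ℝ)).neg
      refine h1.congr_deriv ?_
      simp only [id]
      field_simp
    rw [intervalIntegral.integral_eq_sub_of_hasDerivAt hd
      (Continuous.intervalIntegrable (by fun_prop) _ _),
      show 2 * (q * Real.pi / 4) / (q : ℝ) = Real.pi / 2 by field_simp; ring,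
      show 2 * (Real.pi / 2) / (q : ℝ) = Real.pi / q by ring, Real.cos_pi_div_two]
    ring
  rw [intervalIntegral.integral_congr_ae hsplit, intervalIntegral.integral_add
    (Continuous.intervalIntegrable (by fun_prop) _ _)
    (intervalIntegrable_log_cos_sq_mul_sin q _ _), intervalIntegral.integral_const_mul, hsin,
    rieszIntegral, show (4 : ℝ) = 2 ^ 2 by norm_num, Real.log_pow]
  push_cast
  ring

/-- The correction terms built from `rieszIntegral q` are nonnegative and at most
`π ^ 2 / (3 q (q ^ 2 - 1))`. -/
theorem rieszIntegral_correction_mem_Icc {q : ℕ} (hq : 4 ≤ q) (hq_even : Even q) :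
    2 * Real.log 2 / q + 2 / ((q : ℝ) ^ 2 * Real.cos (Real.pi / q)) * rieszIntegral q ∈
      Set.Icc 0 (2 / (q * ((q : ℝ) ^ 2 - 1)) * (Real.pi ^ 2 / 6)) := by
  have hq4 : (4 : ℝ) ≤ q := by exact_mod_cast hq
  have hcos := cos_pi_div_pos hq
  have hq2 : (0 : ℝ) < (q : ℝ) ^ 2 - 1 := by nlinarith
  have hmem := isClosed_Icc.mem_of_tendsto
    (tendsto_integral_log_one_add_mul_sin q (Real.pi / 2) (q * Real.pi / 4)) (by
      filter_upwards [Ioo_mem_nhdsLT (zero_lt_one' ℝ)] with r hr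
      exact integral_log_one_add_mul_sin_mem_Icc hq hq_even hr.1.le hr.2)
  rw [integral_log_four_cos_sq_mul_sin (by omega)] at hmem
  have hfac : 2 * Real.log 2 / q + 2 / ((q : ℝ) ^ 2 * Real.cos (Real.pi / q)) * rieszIntegral q =
      2 / ((q : ℝ) ^ 2 * Real.cos (Real.pi / q)) *
        (q * Real.log 2 * Real.cos (Real.pi / q) + rieszIntegral q) := by
    field_simp
  rw [hfac]
  refine ⟨mul_nonneg (by positivity) hmem.1, ?_⟩
  refine (mul_le_mul_of_nonneg_left hmem.2 (by positivity)).trans (le_of_eq ?_)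
  field_simp

/-! ### Comparison of the two bounds with the entropy bound -/

theorem entropyBound_error_le {q : ℕ} (hq : 4 ≤ q) :
    2 / (q * ((q : ℝ) ^ 2 - 1)) * (Real.pi ^ 2 / 6) ≤ 2 / (q : ℝ) ^ 2 ∧
      2 / (q * ((q : ℝ) ^ 2 - 1)) * (Real.pi ^ 2 / 6) ≤ 1 / (4 * q) := by
  have hq4 : (4 : ℝ) ≤ q := by exact_mod_cast hq
  have hq2 : (0 : ℝ) < (q : ℝ) ^ 2 - 1 := by nlinarith
  have hpi : Real.pi ^ 2 ≤ 10 := by nlinarith [Real.pi_lt_d2, Real.pi_pos]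
  rw [div_mul_div_comm]
  constructor
  · rw [div_le_div_iff₀ (by positivity) (by positivity)]
    nlinarith [mul_le_mul_of_nonneg_right hpi (sq_nonneg (q : ℝ)),
      mul_nonneg (show (0 : ℝ) ≤ q by linarith) (show (0 : ℝ) ≤ (q - 4) * (q + 4) by nlinarith),
      mul_nonneg (sq_nonneg (q : ℝ)) (show (0 : ℝ) ≤ q - 4 by linarith)]
  · rw [div_le_div_iff₀ (by positivity) (by positivity)]
    nlinarith [mul_le_mul_of_nonneg_right hpi (show (0 : ℝ) ≤ q by linarith),
      mul_nonneg (show (0 : ℝ) ≤ q by linarith) (show (0 : ℝ) ≤ (q - 4) * (q + 4) by nlinarith)]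

theorem two_div_sq_le_neg_log_cos {q : ℕ} (hq : 4 ≤ q) :
    2 / (q : ℝ) ^ 2 ≤ -Real.log (Real.cos (Real.pi / q)) := by
  have hq4 : (4 : ℝ) ≤ q := by exact_mod_cast hq
  have hcos := cos_pi_div_pos hq
  have h1 : Real.log (Real.cos (Real.pi / q) ^ 2) ≤ Real.cos (Real.pi / q) ^ 2 - 1 :=
    Real.log_le_sub_one_of_pos (by positivity)
  rw [Real.log_pow, Real.cos_sq'] at h1
  have h2 := Real.mul_le_sin (div_nonneg Real.pi_pos.le (by linarith : (0 : ℝ) ≤ q))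
    (div_le_div_of_nonneg_left Real.pi_pos.le two_pos (by linarith))
  have h3 : 2 / Real.pi * (Real.pi / q) = 2 / q := by
    have := Real.pi_ne_zero
    field_simp
  rw [h3] at h2
  have h4 : (2 / (q : ℝ)) ^ 2 ≤ Real.sin (Real.pi / q) ^ 2 :=
    pow_le_pow_left₀ (by positivity) h2 2
  have h5 : (2 / (q : ℝ)) ^ 2 = 2 * (2 / (q : ℝ) ^ 2) := by ring
  push_cast at h1
  linarith

theorem neg_log_cos_le {q : ℕ} (hq : 4 ≤ q) :
    -Real.log (Real.cos (Real.pi / q)) ≤ 2 / q := by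
  have hq4 : (4 : ℝ) ≤ q := by exact_mod_cast hq
  have hcos := cos_pi_div_pos hq
  have hpi : Real.pi ^ 2 ≤ 10 := by nlinarith [Real.pi_lt_d2, Real.pi_pos]
  have h1 := Real.one_sub_inv_le_log_of_pos hcos
  have h2 := Real.one_sub_sq_div_two_le_cos (x := Real.pi / q)
  have h3 : 1 - 5 / (q : ℝ) ^ 2 ≤ Real.cos (Real.pi / q) := by
    refine le_trans ?_ h2
    rw [div_pow, div_div, mul_comm, ← div_div]
    gcongr
    linarith
  have h4 : (0 : ℝ) < 1 - 5 / (q : ℝ) ^ 2 := by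
    rw [sub_pos, div_lt_one (by positivity)]
    nlinarith
  have h5 : (Real.cos (Real.pi / q))⁻¹ ≤ (1 - 5 / (q : ℝ) ^ 2)⁻¹ := inv_anti₀ h4 h3
  have h6 : (1 - 5 / (q : ℝ) ^ 2)⁻¹ ≤ 1 + 2 / (q : ℝ) := by
    rw [inv_le_iff_one_le_mul₀ h4]
    have : (1 - 5 / (q : ℝ) ^ 2) * (1 + 2 / (q : ℝ)) - 1 = (2 * (q : ℝ) ^ 2 - 5 * q - 10) / (q : ℝ) ^ 3 := by
      field_simp
      ring
    have h7 : 0 ≤ (2 * (q : ℝ) ^ 2 - 5 * q - 10) / (q : ℝ) ^ 3 :=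
      div_nonneg (by nlinarith) (by positivity)
    linarith
  linarith

theorem first_bound_le {q : ℕ} (hq : 4 ≤ q) (hq_even : Even q) :
    1 - (1 - Real.log 2) / Real.log q
        - 1 / (q * Real.log q) *
          (2 * Real.log 2 - 2 / (q * Real.cos (Real.pi / q)) * rieszIntegral q)
        - Real.log (Real.cos (Real.pi / q)) / Real.log q ≤
      1 - entropyBound q / Real.log q := by
  have hq4 : (4 : ℝ) ≤ q := by exact_mod_cast hq
  have hlog : 0 < Real.log q := Real.log_pos (by linarith)
  have hcos := cos_pi_div_pos hq
  obtain ⟨-, hJ⟩ := rieszIntegral_correction_mem_Icc hq hq_even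
  have hE := (entropyBound_error_le hq).2
  have hc := neg_log_cos_le hq
  have hl2 : 5 / 8 ≤ Real.log 2 := by linarith [Real.log_two_gt_d9]
  have key : entropyBound q ≤ 1 - Real.log 2 + 4 * Real.log 2 / q -
      (2 * Real.log 2 / q + 2 / ((q : ℝ) ^ 2 * Real.cos (Real.pi / q)) * rieszIntegral q) +
      Real.log (Real.cos (Real.pi / q)) := by
    -- Of `4 log 2 / q ≥ 5 / (2 q)`, the logarithm of the cosine takes `2 / q`, and the error in
    -- `entropyBound` and the correction term take `1 / (4 q)` each.
    have h1 : 4 * (5 / 8) / (q : ℝ) ≤ 4 * Real.log 2 / q := by gcongr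
    have h2 : 4 * (5 / 8) / (q : ℝ) = 1 / (4 * q) + 1 / (4 * q) + 2 / q := by
      field_simp
      norm_num
    unfold entropyBound
    linarith
  have := div_le_div_of_nonneg_right key hlog.le
  refine le_trans (le_of_eq ?_) (sub_le_sub_left this 1)
  field_simp
  ring

theorem second_bound_le {q : ℕ} (hq : 4 ≤ q) (hq_even : Even q) :
    1 - (1 - Real.log 2) / Real.log q
        - 1 / (q * Real.log q) *
          (2 * Real.log 2 + 2 / (q * Real.cos (Real.pi / q)) * rieszIntegral q)
        + Real.log (Real.cos (Real.pi / q)) / Real.log q ≤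
      1 - entropyBound q / Real.log q := by
  have hq4 : (4 : ℝ) ≤ q := by exact_mod_cast hq
  have hlog : 0 < Real.log q := Real.log_pos (by linarith)
  have hcos := cos_pi_div_pos hq
  obtain ⟨hJ, -⟩ := rieszIntegral_correction_mem_Icc hq hq_even
  have key : entropyBound q ≤ 1 - Real.log 2 +
      (2 * Real.log 2 / q + 2 / ((q : ℝ) ^ 2 * Real.cos (Real.pi / q)) * rieszIntegral q) -
      Real.log (Real.cos (Real.pi / q)) := by
    unfold entropyBound
    linarith [(entropyBound_error_le hq).1, two_div_sq_le_neg_log_cos hq]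
  have := div_le_div_of_nonneg_right key hlog.le
  refine le_trans (le_of_eq ?_) (sub_le_sub_left this 1)
  field_simp
  ring

/-! ### A moment bound for the partial products -/

theorem exp_le_one_add_add_sq {u : ℝ} (hu : u ≤ 1) : Real.exp u ≤ 1 + u + u ^ 2 := by
  rcases le_or_gt (-1) u with h | h
  · linarith [(abs_le.1 (Real.abs_exp_sub_one_sub_id_le (abs_le.2 ⟨h, hu⟩))).2]
  · nlinarith [Real.exp_le_one_iff.2 (show u ≤ 0 by linarith)]

theorem mul_log_sq_le {t : ℝ} (h0 : 0 ≤ t) (h2 : t ≤ 2) : t * Real.log t ^ 2 ≤ 4 := by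
  rcases h0.eq_or_lt with rfl | h0
  · simp
  rcases le_or_gt t 1 with h1 | h1
  · have h := Real.abs_log_mul_self_rpow_lt t (1 / 2) h0 h1 (by norm_num)
    rw [← Real.sqrt_eq_rpow] at h
    have hsq : (Real.log t * √t) ^ 2 ≤ 2 ^ 2 := by
      refine sq_le_sq' ?_ ?_ <;> linarith [(abs_lt.1 h).1, (abs_lt.1 h).2]
    rw [mul_pow, Real.sq_sqrt h0.le] at hsq
    linarith
  · have h3 : Real.log t ≤ 1 := by linarith [Real.log_le_sub_one_of_pos h0]
    have h4 : 0 ≤ Real.log t := Real.log_nonneg h1.le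
    nlinarith [pow_le_one₀ h4 h3 (n := 2), sq_nonneg (Real.log t)]

/-- Second order expansion of `δ ↦ t ^ (1 + δ)` at `0`, uniform in `t ∈ [0, 2]` because
`t log ^ 2 t` stays bounded. -/
theorem rpow_one_add_le {t δ : ℝ} (h0 : 0 ≤ t) (h2 : t ≤ 2) (hδ : 0 < δ) (hδ1 : δ ≤ 1) :
    t ^ (1 + δ) ≤ t + δ * (t * Real.log t) + 4 * δ ^ 2 := by
  rcases h0.eq_or_lt with rfl | h0
  · rw [Real.zero_rpow (by linarith)]
    simp
    positivity
  have hlog : Real.log t ≤ 1 := by linarith [Real.log_le_sub_one_of_pos h0]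
  have hu : δ * Real.log t ≤ 1 :=
    (mul_le_mul_of_nonneg_left hlog hδ.le).trans (by linarith)
  have h1 := mul_le_mul_of_nonneg_left (exp_le_one_add_add_sq hu) h0.le
  have h3 := mul_le_mul_of_nonneg_left (mul_log_sq_le h0.le h2) (sq_nonneg δ)
  rw [Real.rpow_add h0, Real.rpow_one, Real.rpow_def_of_pos h0, mul_comm (Real.log t)]
  nlinarith

theorem rieszPartial_one_le_two {a : ℝ} (ha : a ∈ Set.Icc (-1 : ℝ) 1) (q : ℕ) (x : UnitAddCircle) :
    rieszPartial a q 1 x ≤ 2 := by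
  induction x using QuotientAddGroup.induction_on with
  | H t =>
    refine (rieszPartial_one_coe a q t).trans_le ?_
    have : |a * Real.cos (2 * Real.pi * t)| ≤ 1 := by
      rw [abs_mul]
      exact mul_le_one₀ (abs_le.2 ha) (abs_nonneg _) (Real.abs_cos_le_one _)
    linarith [(abs_le.1 this).2]

theorem exists_avg_rpow_le {q : ℕ} (hq : 4 ≤ q) (hq_even : Even q) {a : ℝ}
    (ha : a ∈ Set.Icc (-1 : ℝ) 1) {c : ℝ} (hc : entropyBound q < c) :
    ∃ δ : ℝ, 0 < δ ∧ ∀ x : UnitAddCircle, (∑ i ∈ Finset.range q,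
      rieszPartial a q 1 (x + ((i : ℝ) / q : ℝ)) ^ (1 + δ)) / q ≤ Real.exp (δ * c) := by
  have hq0 : (0 : ℝ) < q := by exact_mod_cast (by omega : 0 < q)
  set δ := min 1 ((c - entropyBound q) / 4)
  have hδ : 0 < δ := lt_min one_pos (by linarith)
  have hδ1 : δ ≤ 1 := min_le_left _ _
  have hδ2 : 4 * δ ≤ c - entropyBound q := by linarith [min_le_right 1 ((c - entropyBound q) / 4)]
  refine ⟨δ, hδ, fun x => ?_⟩
  induction x using QuotientAddGroup.induction_on with
  | H t =>
    have hw : ∀ i : ℕ, rieszPartial a q 1 ((t : UnitAddCircle) + ((i : ℝ) / q : ℝ)) =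
        1 + a * Real.cos (2 * Real.pi * (t + i / q)) := fun i => by
      rw [← AddCircle.coe_add, rieszPartial_one_coe]
    have hpt := Finset.sum_le_sum (s := Finset.range q) fun i _ =>
      rpow_one_add_le (rieszPartial_nonneg ha q 1 ((t : UnitAddCircle) + ((i : ℝ) / q : ℝ)))
        (rieszPartial_one_le_two ha q _) hδ hδ1
    have hent := avg_entropy_le hq hq_even ha t
    have hcos : ∑ i ∈ Finset.range q, Real.cos (2 * Real.pi * (t + i / q)) = 0 := by
      simpa using sum_cos_eq_zero (q := q) (n := 1) (by omega)
        (fun h => by have := Nat.le_of_dvd one_pos h; omega) t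
    have hmean : ∑ i ∈ Finset.range q, (1 + a * Real.cos (2 * Real.pi * (t + i / q))) = q := by
      rw [Finset.sum_add_distrib, ← Finset.mul_sum, hcos]
      simp
    refine (div_le_div_of_nonneg_right hpt hq0.le).trans ?_
    simp_rw [hw]
    rw [Finset.sum_add_distrib, Finset.sum_add_distrib, hmean, ← Finset.mul_sum, Finset.sum_const,
      Finset.card_range, nsmul_eq_mul, add_div, add_div, div_self hq0.ne', mul_div_assoc,
      mul_div_cancel_left₀ _ hq0.ne']
    have h1 := mul_le_mul_of_nonneg_left hent hδ.le
    have h2 := mul_le_mul_of_nonneg_left hδ2 hδ.le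
    linarith [Real.add_one_le_exp (δ * c)]

theorem integral_rieszPartial_rpow_le {q : ℕ} (hq : 4 ≤ q) {a : ℝ} (ha : a ∈ Set.Icc (-1 : ℝ) 1)
    {δ M : ℝ} (hδ : 0 < δ) (hM : ∀ x : UnitAddCircle, (∑ i ∈ Finset.range q,
      rieszPartial a q 1 (x + ((i : ℝ) / q : ℝ)) ^ (1 + δ)) / q ≤ M) (n m : ℕ) :
    ∫ x : UnitAddCircle, rieszPartial a q n x ^ (1 + δ) * rieszPartial a q m (q ^ n • x) ≤
      M ^ n := by
  have hcont : ∀ k, Continuous fun x => rieszPartial a q k x ^ (1 + δ) := fun k =>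
    (continuous_rieszPartial a q k).rpow_const fun _ => Or.inr (by linarith)
  have hM0 : 0 ≤ M := le_trans (div_nonneg (Finset.sum_nonneg fun i _ =>
    Real.rpow_nonneg (rieszPartial_nonneg ha q 1 _) _) (Nat.cast_nonneg q)) (hM 0)
  induction n with
  | zero => simp [rieszPartial_zero, integral_rieszPartial a hq]
  | succ n ih =>
    have hcm : Continuous fun x : UnitAddCircle => rieszPartial a q m (q ^ n • x) :=
      (continuous_rieszPartial a q m).comp (continuous_nsmul _)
    have hstep := integral_mul_comp_nsmul_le (Q := q)
      (h := fun x => rieszPartial a q n x ^ (1 + δ) * rieszPartial a q m (q ^ n • x))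
      (by omega) (hcont 1) ((hcont n).mul hcm)
      (fun x => mul_nonneg (Real.rpow_nonneg (rieszPartial_nonneg ha q n x) _)
        (rieszPartial_nonneg ha q m _)) hM
    rw [pow_succ' M n]
    refine le_trans (le_of_eq ?_) (hstep.trans (mul_le_mul_of_nonneg_left ih hM0))
    congr 1
    ext x
    rw [add_comm n 1, rieszPartial_add, pow_one,
      Real.mul_rpow (rieszPartial_nonneg ha q 1 x) (rieszPartial_nonneg ha q n _),
      smul_smul, ← pow_succ, add_comm 1 n, mul_assoc]

/-- Integrals against the Riesz product are bounded through the factorization of the partial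
products of index at least `n`. -/
theorem integral_rieszProduct_le {q : ℕ} (hq : 4 ≤ q) {a : ℝ} (ha : a ∈ Set.Icc (-1 : ℝ) 1)
    {g : UnitAddCircle → ℝ} (hg : Continuous g) {C : ℝ} (n : ℕ)
    (h : ∀ m, ∫ x, g x * (rieszPartial a q n x * rieszPartial a q m (q ^ n • x)) ≤ C) :
    ∫ x, g x ∂(rieszProduct a q : Measure UnitAddCircle) ≤ C := by
  have hlim := FiniteMeasure.tendsto_iff_forall_integral_tendsto.1
    (tendsto_rieszPartialMeasure ha hq) (BoundedContinuousFunction.mkOfCompact ⟨g, hg⟩)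
  refine le_of_tendsto hlim ?_
  filter_upwards [eventually_ge_atTop n] with N hN
  obtain ⟨m, rfl⟩ := Nat.exists_eq_add_of_le hN
  rw [integral_rieszPartialMeasure ha]
  refine le_trans (le_of_eq ?_) (h m)
  congr 1
  ext x
  rw [rieszPartial_add, smul_eq_mul, mul_comm]
  rfl

theorem integral_rpow_rieszProduct_le {q : ℕ} (hq : 4 ≤ q) {a : ℝ} (ha : a ∈ Set.Icc (-1 : ℝ) 1)
    {δ M : ℝ} (hδ : 0 < δ) (hM : ∀ x : UnitAddCircle, (∑ i ∈ Finset.range q,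
      rieszPartial a q 1 (x + ((i : ℝ) / q : ℝ)) ^ (1 + δ)) / q ≤ M) (n : ℕ) :
    ∫ x, rieszPartial a q n x ^ δ ∂(rieszProduct a q : Measure UnitAddCircle) ≤ M ^ n := by
  refine integral_rieszProduct_le hq ha
    ((continuous_rieszPartial a q n).rpow_const fun _ => Or.inr hδ.le) n fun m => ?_
  refine le_trans (le_of_eq ?_) (integral_rieszPartial_rpow_le hq ha hδ hM n m)
  congr 1
  ext x
  rw [add_comm 1 δ, Real.rpow_add_one' (rieszPartial_nonneg ha q n x) (by linarith), mul_assoc]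

/-! ### Local bounds where a partial product is small -/

theorem card_filter_norm_add_le {Q : ℕ} (hQ : 0 < Q) (y : UnitAddCircle) :
    ((Finset.range Q).filter fun i : ℕ =>
      ‖y + (((i : ℝ) / Q : ℝ) : UnitAddCircle)‖ ≤ 2 / Q).card ≤ 5 := by
  have hQ' : (0 : ℝ) < Q := by exact_mod_cast hQ
  induction y using QuotientAddGroup.induction_on with
  | H t =>
    -- If `t + i / Q` is within `2 / Q` of the integer `k`, then `i - k Q` is one of five integers,
    -- and `i` is its residue modulo `Q`.
    set T := Finset.Icc ⌈-(Q * t) - 2⌉ (⌈-(Q * t) - 2⌉ + 4) with hT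
    have hcard : T.card = 5 := by
      rw [hT, Int.card_Icc]
      omega
    rw [← hcard]
    refine (Finset.card_le_card (t := T.image fun l : ℤ => (l % Q).toNat) ?_).trans
      Finset.card_image_le
    intro i hi
    rw [Finset.mem_filter, Finset.mem_range] at hi
    obtain ⟨hiQ, hi⟩ := hi
    change ‖((t : ℝ) : UnitAddCircle) + _‖ ≤ _ at hi
    rw [← AddCircle.coe_add, UnitAddCircle.norm_eq, le_div_iff₀ hQ', ← abs_of_pos hQ', ← abs_mul,
      abs_of_pos hQ'] at hi
    set k := round (t + (i : ℝ) / Q)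
    have e : (t + (i : ℝ) / Q - k) * Q = Q * t + (i - k * Q) := by
      field_simp
      ring
    rw [e, abs_le] at hi
    refine Finset.mem_image.2 ⟨(i : ℤ) - k * Q, ?_, ?_⟩
    · rw [hT, Finset.mem_Icc]
      constructor
      · rw [Int.ceil_le]
        push_cast
        linarith
      · have h1 := Int.le_ceil (-(Q * t) - 2)
        have : (((i : ℤ) - k * Q : ℤ) : ℝ) ≤ ((⌈-(Q * t) - 2⌉ + 4 : ℤ) : ℝ) := by
          push_cast
          linarith
        exact_mod_cast this
    · rw [Int.sub_mul_emod_self_right, Int.emod_eq_of_lt (by positivity) (by exact_mod_cast hiQ)]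
      simp

/-- A continuous bump at `x₀`: it is `1` at distance at most `1 / Q` and vanishes at distance at
least `2 / Q`. -/
noncomputable def tent (Q : ℕ) (x₀ x : UnitAddCircle) : ℝ := max 0 (min 1 (2 - Q * dist x x₀))

theorem continuous_tent (Q : ℕ) (x₀ : UnitAddCircle) : Continuous (tent Q x₀) := by
  unfold tent
  fun_prop

theorem tent_nonneg (Q : ℕ) (x₀ x : UnitAddCircle) : 0 ≤ tent Q x₀ x := le_max_left _ _

theorem avg_tent_le {Q : ℕ} (hQ : 0 < Q) (x₀ x : UnitAddCircle) :
    (∑ i ∈ Finset.range Q, tent Q x₀ (x + ((i : ℝ) / Q : ℝ))) / Q ≤ 5 / Q := by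
  have hQ' : (0 : ℝ) < Q := by exact_mod_cast hQ
  refine div_le_div_of_nonneg_right ?_ hQ'.le
  have hle : ∀ i ∈ Finset.range Q, tent Q x₀ (x + ((i : ℝ) / Q : ℝ)) ≤
      if ‖(x - x₀) + (((i : ℝ) / Q : ℝ) : UnitAddCircle)‖ ≤ 2 / Q then 1 else 0 := by
    intro i _
    split_ifs with h
    · exact max_le zero_le_one (min_le_left _ _)
    · rw [not_le, div_lt_iff₀ hQ'] at h
      refine max_le le_rfl ((min_le_right _ _).trans ?_)
      rw [dist_eq_norm, add_sub_right_comm]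
      linarith
  refine (Finset.sum_le_sum hle).trans ?_
  rw [Finset.sum_boole]
  exact_mod_cast card_filter_norm_add_le hQ (x - x₀)

/-- Where the `n`-th partial product is at most `L`, a ball of radius `q ^ (-n)` has mass at most
`5 L q ^ (-n)`: the remaining factor of the Riesz product is `q ^ (-n)`-periodic with mean one. -/
theorem rieszProduct_closedBall_inter_le {q : ℕ} (hq : 4 ≤ q) {a : ℝ}
    (ha : a ∈ Set.Icc (-1 : ℝ) 1) (n : ℕ) {L : ℝ} (hL : 0 < L) (x₀ : UnitAddCircle) :
    (rieszProduct a q : Measure UnitAddCircle)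
      (Metric.closedBall x₀ (1 / (q : ℝ) ^ n) ∩ {x | rieszPartial a q n x ≤ L}) ≤
        ENNReal.ofReal (L * (5 / (q : ℝ) ^ n)) := by
  have hQ : 0 < q ^ n := by positivity
  have hQ' : (0 : ℝ) < (q : ℝ) ^ n := by positivity
  have hPn := continuous_rieszPartial a q n
  set S := Metric.closedBall x₀ (1 / (q : ℝ) ^ n) ∩ {x | rieszPartial a q n x ≤ L}
  have hS : MeasurableSet S :=
    (Metric.isClosed_closedBall.inter (isClosed_le hPn continuous_const)).measurableSet
  -- The test function: it dominates the indicator of `S`, and its product with the partial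
  -- product is at most `L` times the bump.
  set g : UnitAddCircle → ℝ := fun x =>
    tent (q ^ n) x₀ x * (L / max L (rieszPartial a q n x)) with hg_def
  have hmax : ∀ x, 0 < max L (rieszPartial a q n x) := fun x => lt_max_of_lt_left hL
  have hg : Continuous g :=
    (continuous_tent _ _).mul (continuous_const.div (continuous_const.max hPn)
      fun x => (hmax x).ne')
  have hg0 : ∀ x, 0 ≤ g x := fun x =>
    mul_nonneg (tent_nonneg _ _ _) (div_nonneg hL.le (hmax x).le)
  have hgP : ∀ x, g x * rieszPartial a q n x ≤ L * tent (q ^ n) x₀ x := fun x => by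
    rw [hg_def, mul_assoc, mul_comm L]
    refine mul_le_mul_of_nonneg_left ?_ (tent_nonneg _ _ _)
    rw [div_mul_eq_mul_div, div_le_iff₀ (hmax x)]
    exact mul_le_mul_of_nonneg_left (le_max_right _ _) hL.le
  have hint : ∫ x, g x ∂(rieszProduct a q : Measure UnitAddCircle) ≤ L * (5 / (q : ℝ) ^ n) := by
    refine integral_rieszProduct_le hq ha hg n fun m => ?_
    have hPm := continuous_rieszPartial a q m
    have hPm' : Continuous fun x : UnitAddCircle => rieszPartial a q m (q ^ n • x) :=
      hPm.comp (continuous_nsmul _)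
    have hT := continuous_tent (q ^ n) x₀
    have h1 : ∫ x, g x * (rieszPartial a q n x * rieszPartial a q m (q ^ n • x)) ≤
        ∫ x, L * (tent (q ^ n) x₀ x * rieszPartial a q m (q ^ n • x)) := by
      refine integral_mono (integrable_of_continuous (by fun_prop))
        (integrable_of_continuous (by fun_prop)) fun x => ?_
      have := mul_le_mul_of_nonneg_right (hgP x) (rieszPartial_nonneg ha q m (q ^ n • x))
      simp only
      linarith
    refine h1.trans ?_
    rw [integral_const_mul]
    refine mul_le_mul_of_nonneg_left ?_ hL.le
    have h2 := integral_mul_comp_nsmul_le hQ.ne' hT hPm (fun x => rieszPartial_nonneg ha q m x)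
      (avg_tent_le hQ x₀)
    rwa [integral_rieszPartial a hq, mul_one, Nat.cast_pow] at h2
  have hind : (rieszProduct a q : Measure UnitAddCircle).real S ≤
      ∫ x, g x ∂(rieszProduct a q : Measure UnitAddCircle) := by
    rw [← integral_indicator_one hS]
    refine integral_mono ((integrable_const 1).indicator hS) (integrable_of_continuous hg)
      fun x => Set.indicator_le' (fun y hy => ?_) (fun y _ => hg0 y) x
    have h1 : tent (q ^ n) x₀ y = 1 := by
      have hy1 : dist y x₀ ≤ 1 / (q : ℝ) ^ n := hy.1
      rw [le_div_iff₀ hQ', mul_comm] at hy1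
      rw [tent, Nat.cast_pow, min_eq_left (by linarith), max_eq_right zero_le_one]
    have hy2 : rieszPartial a q n y ≤ L := hy.2
    rw [hg_def]
    simp only [h1, max_eq_left hy2, div_self hL.ne', mul_one, Pi.one_apply, le_refl]
  rw [← ofReal_measureReal]
  exact ENNReal.ofReal_le_ofReal (hind.trans hint)

/-! ### The Hausdorff dimension of sets of positive measure -/

/-- The set on which every partial product of index `n ≥ k` is at most `e ^ (n c)`. -/
def tameSet (a : ℝ) (q : ℕ) (c : ℝ) (k : ℕ) : Set UnitAddCircle :=
  {x | ∀ n ≥ k, rieszPartial a q n x ≤ Real.exp (n * c)}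

theorem measurableSet_tameSet (a : ℝ) (q : ℕ) (c : ℝ) (k : ℕ) : MeasurableSet (tameSet a q c k) := by
  have : tameSet a q c k = ⋂ n ≥ k, {x | rieszPartial a q n x ≤ Real.exp (n * c)} := by
    ext x
    simp [tameSet]
  rw [this]
  exact MeasurableSet.biInter (Set.to_countable _) fun n _ =>
    (isClosed_le (continuous_rieszPartial a q n) continuous_const).measurableSet

/-- By the moment bound and Borel–Cantelli, almost every point is tame. -/
theorem ae_exists_mem_tameSet {q : ℕ} (hq : 4 ≤ q) (hq_even : Even q) {a : ℝ}
    (ha : a ∈ Set.Icc (-1 : ℝ) 1) {c : ℝ} (hc : entropyBound q < c) :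
    ∀ᵐ x ∂(rieszProduct a q : Measure UnitAddCircle), ∃ k, x ∈ tameSet a q c k := by
  obtain ⟨b, hb, hbc⟩ := exists_between hc
  obtain ⟨δ, hδ, hM⟩ := exists_avg_rpow_le hq hq_even ha hb
  set μ := (rieszProduct a q : Measure UnitAddCircle)
  have hbad : ∀ n : ℕ, μ {x | Real.exp (n * c) < rieszPartial a q n x} ≤
      ENNReal.ofReal (Real.exp (-(δ * (c - b))) ^ n) := by
    intro n
    have h0 := integral_rpow_rieszProduct_le hq ha hδ hM n
    have hcont : Continuous fun x => rieszPartial a q n x ^ δ :=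
      (continuous_rieszPartial a q n).rpow_const fun _ => Or.inr hδ.le
    have h1 := mul_meas_ge_le_integral_of_nonneg (μ := μ)
      (.of_forall fun x => Real.rpow_nonneg (rieszPartial_nonneg ha q n x) δ)
      (integrable_of_continuous hcont) (Real.exp (n * c) ^ δ)
    have hpos : 0 < Real.exp (n * c) ^ δ := Real.rpow_pos_of_pos (Real.exp_pos _) _
    have h2 : μ.real {x | Real.exp (n * c) ^ δ ≤ rieszPartial a q n x ^ δ} ≤
        Real.exp (-(δ * (c - b))) ^ n := by
      rw [← le_div_iff₀' hpos] at h1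
      refine h1.trans ?_
      rw [div_le_iff₀ hpos]
      refine h0.trans (le_of_eq ?_)
      rw [← Real.exp_nat_mul, ← Real.exp_nat_mul, ← Real.exp_mul, ← Real.exp_add]
      congr 1
      ring
    have h3 : μ {x | Real.exp (n * c) < rieszPartial a q n x} ≤
        μ {x | Real.exp (n * c) ^ δ ≤ rieszPartial a q n x ^ δ} :=
      measure_mono fun x (hx : Real.exp (n * c) < _) =>
        Real.rpow_le_rpow (Real.exp_pos _).le hx.le hδ.le
    refine h3.trans ?_
    rw [← ofReal_measureReal]
    exact ENNReal.ofReal_le_ofReal h2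
  have hρ : Real.exp (-(δ * (c - b))) < 1 := by
    rw [Real.exp_lt_one_iff]
    have : 0 < δ * (c - b) := mul_pos hδ (by linarith)
    linarith
  have hsum : ∑' n : ℕ, μ {x | Real.exp (n * c) < rieszPartial a q n x} ≠ ∞ :=
    ne_top_of_le_ne_top
      (summable_geometric_of_lt_one (Real.exp_pos _).le hρ).tsum_ofReal_ne_top
      (ENNReal.tsum_le_tsum hbad)
  filter_upwards [ae_eventually_notMem hsum] with x hx
  obtain ⟨k, hk⟩ := eventually_atTop.1 hx
  exact ⟨k, fun n hn => not_lt.1 (hk n hn)⟩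

theorem rieszProduct_inter_tameSet_le {q : ℕ} (hq : 4 ≤ q) {a : ℝ}
    (ha : a ∈ Set.Icc (-1 : ℝ) 1) {s : ℝ} {k n : ℕ} (hn : k ≤ n) {U : Set UnitAddCircle}
    (hU : Metric.ediam U ≤ ENNReal.ofReal (((q : ℝ)⁻¹) ^ n)) :
    (rieszProduct a q : Measure UnitAddCircle)
      (U ∩ tameSet a q ((1 - s) * Real.log q) k) ≤ ENNReal.ofReal (5 * ((q : ℝ)⁻¹ ^ n) ^ s) := by
  have hq0 : (0 : ℝ) < q := by exact_mod_cast (by omega : 0 < q)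
  rcases (U ∩ tameSet a q ((1 - s) * Real.log q) k).eq_empty_or_nonempty with h | ⟨x, hxU, -⟩
  · simp [h]
  have hsub : U ∩ tameSet a q ((1 - s) * Real.log q) k ⊆
      Metric.closedBall x (1 / (q : ℝ) ^ n) ∩
        {x | rieszPartial a q n x ≤ Real.exp (n * ((1 - s) * Real.log q))} := by
    rintro y ⟨hyU, hy⟩
    refine ⟨?_, hy n hn⟩
    have h1 := (Metric.edist_le_ediam_of_mem hyU hxU).trans hU
    rw [edist_dist] at h1
    have h2 := (ENNReal.ofReal_le_ofReal_iff (by positivity)).1 h1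
    rwa [Metric.mem_closedBall, one_div, ← inv_pow]
  refine (measure_mono hsub).trans
    ((rieszProduct_closedBall_inter_le hq ha n (Real.exp_pos _) x).trans (le_of_eq ?_))
  congr 1
  have h3 : (q : ℝ) ^ n = Real.exp (n * Real.log q) := by
    rw [Real.exp_nat_mul, Real.exp_log hq0]
  rw [inv_pow, Real.inv_rpow (by positivity), h3, ← Real.exp_mul, div_eq_mul_inv, ← Real.exp_neg,
    ← Real.exp_neg, mul_left_comm, ← Real.exp_add]
  congr 2
  ring

/-- The mass distribution principle on the tame set: sets of small diameter have mass at most a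
constant times the `s`-th power of their diameter. -/
theorem le_dimH_of_measure_inter_tameSet_ne_zero {q : ℕ} (hq : 4 ≤ q) {a : ℝ}
    (ha : a ∈ Set.Icc (-1 : ℝ) 1) {s : ℝ} (hs : 0 < s) {k : ℕ} {F : Set UnitAddCircle}
    (hF : (rieszProduct a q : Measure UnitAddCircle)
      (F ∩ tameSet a q ((1 - s) * Real.log q) k) ≠ 0) :
    ENNReal.ofReal s ≤ dimH F := by
  have hq4 : (4 : ℝ) ≤ q := by exact_mod_cast hq
  have hq0 : (0 : ℝ) < q := by linarith
  have hinv0 : (0 : ℝ) < (q : ℝ)⁻¹ := by positivity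
  have hinv1 : (q : ℝ)⁻¹ < 1 := inv_lt_one_of_one_lt₀ (by linarith)
  set μ := (rieszProduct a q : Measure UnitAddCircle)
  set E := tameSet a q ((1 - s) * Real.log q) k
  have hE : MeasurableSet E := measurableSet_tameSet _ _ _ _
  set K : ℝ := 5 * (q : ℝ) ^ s
  have hK : 0 < K := by positivity
  have hmass : ∀ U : Set UnitAddCircle, Metric.ediam U ≤ ENNReal.ofReal ((q : ℝ)⁻¹ ^ k) →
      μ (U ∩ E) ≤ ENNReal.ofReal K * Metric.ediam U ^ s := by
    intro U hU
    rcases eq_or_ne (Metric.ediam U) 0 with h0 | h0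
    -- A set of diameter zero obeys the bounds at all scales, so it has mass zero.
    · have hlim : Tendsto (fun n : ℕ => ENNReal.ofReal (5 * ((q : ℝ)⁻¹ ^ n) ^ s)) atTop (𝓝 0) := by
        have h1 : Tendsto (fun n : ℕ => (q : ℝ)⁻¹ ^ n) atTop (𝓝 0) :=
          tendsto_pow_atTop_nhds_zero_of_lt_one hinv0.le hinv1
        have h2 := ENNReal.tendsto_ofReal ((h1.rpow_const (Or.inr hs.le)).const_mul 5)
        simpa [Real.zero_rpow hs.ne'] using h2
      refine le_trans (ge_of_tendsto hlim ?_) zero_le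
      filter_upwards [eventually_ge_atTop k] with n hn
      exact rieszProduct_inter_tameSet_le hq ha hn (by simp [h0])
    · have htop : Metric.ediam U ≠ ∞ := ne_top_of_le_ne_top ENNReal.ofReal_ne_top hU
      have hd0 : 0 < (Metric.ediam U).toReal := ENNReal.toReal_pos h0 htop
      have hdk : (Metric.ediam U).toReal ≤ (q : ℝ)⁻¹ ^ k :=
        ENNReal.toReal_le_of_le_ofReal (by positivity) hU
      obtain ⟨n, hn1, hn2⟩ := exists_nat_pow_near_of_lt_one hd0
        (hdk.trans (pow_le_one₀ hinv0.le hinv1.le)) hinv0 hinv1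
      have hkn : k ≤ n := by
        have := (pow_lt_pow_iff_right_of_lt_one₀ hinv0 hinv1).1 (hn1.trans_le hdk)
        omega
      refine (rieszProduct_inter_tameSet_le hq ha hkn ?_).trans ?_
      · rw [← ENNReal.ofReal_toReal htop]
        exact ENNReal.ofReal_le_ofReal hn2
      · rw [← ENNReal.ofReal_toReal htop]
        rw [ENNReal.ofReal_rpow_of_pos hd0, ← ENNReal.ofReal_mul hK.le]
        refine ENNReal.ofReal_le_ofReal ?_
        have h1 : (q : ℝ)⁻¹ ^ n = q * (q : ℝ)⁻¹ ^ (n + 1) := by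
          rw [pow_succ]
          field_simp
        rw [h1, Real.mul_rpow hq0.le (by positivity), ← mul_assoc]
        exact mul_le_mul_of_nonneg_left
          (Real.rpow_le_rpow (by positivity) hn1.le hs.le) hK.le
  have hK0 : ENNReal.ofReal K ≠ 0 := by simpa using hK
  have hle := Measure.le_hausdorffMeasure s ((ENNReal.ofReal K)⁻¹ • μ.restrict E)
    (ENNReal.ofReal ((q : ℝ)⁻¹ ^ k)) (by rw [ENNReal.ofReal_pos]; positivity) fun U hU => by
      rw [Measure.smul_apply, Measure.restrict_apply' hE, smul_eq_mul,
        ENNReal.inv_mul_le_iff hK0 ENNReal.ofReal_ne_top]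
      exact hmass U hU
  refine le_dimH_of_hausdorffMeasure_ne_zero (d := s.toNNReal) fun h0 => hF ?_
  rw [Real.coe_toNNReal _ hs.le] at h0
  have h1 := hle F
  rw [h0, Measure.smul_apply, Measure.restrict_apply' hE, smul_eq_mul, nonpos_iff_eq_zero,
    mul_eq_zero] at h1
  exact h1.resolve_left (ENNReal.inv_ne_zero.2 ENNReal.ofReal_ne_top)

theorem le_lowerHausdorffDim_rieszProduct {q : ℕ} (hq : 4 ≤ q) (hq_even : Even q) {a : ℝ}
    (ha : a ∈ Set.Icc (-1 : ℝ) 1) :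
    ENNReal.ofReal (1 - entropyBound q / Real.log q) ≤
      lowerHausdorffDim (rieszProduct a q : Measure UnitAddCircle) := by
  have hlog : 0 < Real.log q := Real.log_pos (by exact_mod_cast (by omega : 1 < q))
  refine le_sInf ?_
  rintro α ⟨F, -, hF, hα⟩
  refine le_trans (le_of_forall_lt fun β hβ => ?_) hα
  lift β to NNReal using hβ.ne_top
  have hβ' : (β : ℝ) < 1 - entropyBound q / Real.log q := by
    by_contra! h
    exact hβ.not_ge ((ENNReal.ofReal_le_ofReal h).trans_eq ENNReal.ofReal_coe_nnreal)
  obtain ⟨s, hβs, hs⟩ := exists_between hβ'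
  have hs0 : 0 < s := β.2.trans_lt hβs
  have hc : entropyBound q < (1 - s) * Real.log q := by
    rw [← div_lt_iff₀ hlog]
    linarith
  obtain ⟨k, hk⟩ : ∃ k, (rieszProduct a q : Measure UnitAddCircle)
      (F ∩ tameSet a q ((1 - s) * Real.log q) k) ≠ 0 := by
    by_contra! hall
    refine hF (measure_mono_null (t := (⋃ k, F ∩ tameSet a q ((1 - s) * Real.log q) k) ∪
      {x | ¬ ∃ k, x ∈ tameSet a q ((1 - s) * Real.log q) k}) (fun x hx => ?_)
      (measure_union_null (measure_iUnion_null hall)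
        (ae_iff.1 (ae_exists_mem_tameSet hq hq_even ha hc))))
    by_cases h : ∃ k, x ∈ tameSet a q ((1 - s) * Real.log q) k
    · obtain ⟨k, hk⟩ := h
      exact Or.inl (Set.mem_iUnion.2 ⟨k, hx, hk⟩)
    · exact Or.inr h
  refine lt_of_lt_of_le ?_ (le_dimH_of_measure_inter_tameSet_ne_zero hq ha hs0 hk)
  rw [← ENNReal.ofReal_coe_nnreal]
  exact (ENNReal.ofReal_lt_ofReal_iff hs0).2 hβs

theorem proposition1p3 (q : ℕ) (hq : 4 ≤ q) (hq_even : Even q) (a : ℝ)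
    (ha : a ∈ Set.Icc (-1 : ℝ) 1) :
    -- the partial products converge weakly, so that the Riesz product is a genuine limit
    Tendsto (rieszPartialMeasure a q) atTop (𝓝 (rieszProduct a q)) ∧
    -- the integral below converges
    IntervalIntegrable (fun z : ℝ => Real.log (Real.cos z ^ 2) * Real.sin (2 * z / q)) volume
      (Real.pi / 2) (q * Real.pi / 4) ∧
    -- the first bound
    ((1 - (1 - Real.log 2) / Real.log q
        - 1 / (q * Real.log q) *
          (2 * Real.log 2 - 2 / (q * Real.cos (Real.pi / q)) * rieszIntegral q)
        - Real.log (Real.cos (Real.pi / q)) / Real.log q : ℝ) : EReal)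
      ≤ (lowerHausdorffDim (rieszProduct a q : Measure UnitAddCircle) : EReal) ∧
    -- the same bound with both signs reversed (stronger for `q ≥ 6`, weaker for `q = 4`)
    ((1 - (1 - Real.log 2) / Real.log q
        - 1 / (q * Real.log q) *
          (2 * Real.log 2 + 2 / (q * Real.cos (Real.pi / q)) * rieszIntegral q)
        + Real.log (Real.cos (Real.pi / q)) / Real.log q : ℝ) : EReal)
      ≤ (lowerHausdorffDim (rieszProduct a q : Measure UnitAddCircle) : EReal) := by
  have hdim : ((1 - entropyBound q / Real.log q : ℝ) : EReal) ≤
      (lowerHausdorffDim (rieszProduct a q : Measure UnitAddCircle) : EReal) := by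
    refine le_trans ?_ (EReal.coe_ennreal_le_coe_ennreal_iff.2
      (le_lowerHausdorffDim_rieszProduct hq hq_even ha))
    rw [EReal.coe_ennreal_ofReal]
    exact EReal.coe_le_coe_iff.2 (le_max_left _ _)
  exact ⟨tendsto_rieszPartialMeasure ha hq, intervalIntegrable_log_cos_sq_mul_sin q _ _,
    (EReal.coe_le_coe_iff.2 (first_bound_le hq hq_even)).trans hdim,
    (EReal.coe_le_coe_iff.2 (second_bound_le hq hq_even)).trans hdim⟩
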